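/- A $d$-dimensional continuous vector addition system (CVAS) is a finite set $\Sigma\subset\mathbb Z^d$, whose elements are also called letters. For configurations $\mathbf x,\mathbf y\in\mathbb Q_{\ge 0}^d$, let $L_\Sigma^{\mathbf x,\mathbf y}$ be the set of words $w=t_1\cdots t_n\in\Sigma^*$ for which there are rationals $\alpha_1,\dots,\alpha_n\in(0,1]$ and configurations $\mathbf x=\mathbf x_0,\mathbf x_1,\dots,\mathbf x_n=\mathbf y$ in $\mathbb Q_{\ge 0}^d$ with $\mathbf x_i=\mathbf x_{i-1}+\alpha_i t_i$ for $1\le i\le n$. A *bubble* over $\Sigma$ is either a *star* $X_A$ with $A\subseteq\Sigma$, or a *gathering* $X_{a_1\dots a_n}^{b_1\dots b_n}$, where $a_1,\dots,a_n\in\Sigma$ are pairwise distinct, $b_1,\dots,b_n$ are pairwise distinct and $\{a_1,\dots,a_n\}=\{b_1,\dots,b_n\}$. We put $L(X_A)=A^*$, and $L(X_{a_1\dots a_n}^{b_1\dots b_n})$ is the set of all words $a_1w_1\cdots a_nw_n\,b_1v_1\cdots b_nv_n$ with $w_i\in\{a_1,\dots,a_i\}^*$ and $v_i\in(\{a_1,\dots,a_n\}\setminus\{b_1,\dots,b_i\})^*$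 for all $i$. A *path-scheme* over $\Sigma$ is an expression $\rho=u_0X_1u_1\cdots X_nu_n$ with words $u_i\in\Sigma^*$ and bubbles $X_i$ over $\Sigma$; its language is $L(\rho)=\{u_0w_1u_1\cdots w_nu_n : w_i\in L(X_i)\text{ for all }i\}$. It is *perfect* (with respect to $\mathbf x,\mathbf y$) if all its bubbles are gatherings and $L(\rho)\cap L_\Sigma^{\mathbf x,\mathbf y}\neq\emptyset$. The *weight* $W(\rho)\in\mathbb N^{|\Sigma|}$ has as its $i$-th component ($1\le i\le|\Sigma|$) the number of bubbles of $\rho$ with exactly $i$ letters, i.e. the stars $X_A$ with $|A|=i$ and the gatherings $X_{a_1\dots a_i}^{b_1\dots b_i}$. Write $u\le_{\mathsf{lex}}v$ for $u,v\in\mathbb N^{|\Sigma|}$ if $u=v$ or $u_i<v_i$ for the largest $i$ with $u_i\ne v_i$. **Theorem (Path-Scheme Decomposition).** There is an algorithm that, given $d$, a CVAS $\Sigma\subset\mathbb Z^d$, configurations $\mathbf x,\mathbf y\in\mathbb Q_{\ge0}^d$ and a path-scheme $\rho$ over $\Sigma$, computes a finite (possibly empty) list of perfect path-schemes $\rho_1,\dots,\rho_m$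 over $\Sigma$ such that $$L(\rho)\cap L_\Sigma^{\mathbf x,\mathbf y}=\Bigl(\bigcup_{i=1}^m L(\rho_i)\Bigr)\cap L_\Sigma^{\mathbf x,\mathbf y}\qquad\text{and}\qquad W(\rho_i)\le_{\mathsf{lex}}W(\rho)\text{ for each }i.$$ -/

import Mathlib

/-! ### Continuous vector addition systems -/

namespace CVAS

/-- Configurations of a `d`-dimensional system: vectors of nonnegative rationals. -/
abbrev Conf (d : ℕ) : Type := Fin d → ℚ≥0

/-- `Step x α t y`: the transition `t`, fired with the fraction `α`, leads from `x` to `y`. That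
no counter becomes negative is enforced by `y : Conf d`. -/
def Step {d : ℕ} (x : Conf d) (α : ℚ) (t : Fin d → ℤ) (y : Conf d) : Prop :=
  0 < α ∧ α ≤ 1 ∧ ∀ i, (y i : ℚ) = (x i : ℚ) + α * (t i : ℚ)

/-- `Reach x w y`: there are firing fractions for the letters of `w` that give a run from `x`
to `y`. A system is a finite set `S` of integer vectors, and its letters are the elements
of `S`. -/
def Reach {d : ℕ} {S : Finset (Fin d → ℤ)} : Conf d → List S → Conf d → Prop
  | x, [], y => x = y
  | x, t :: w, y => ∃ (α : ℚ) (z : Conf d), Step x α t z ∧ Reach z w y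

/-- The transition language of the system `S` between `x` and `y`. -/
def lang {d : ℕ} (S : Finset (Fin d → ℤ)) (x y : Conf d) : Language S :=
  {w | Reach x w y}

end CVAS

/-! ### Path-schemes -/

/-- A bubble over `α` is a star `X_A` or a gathering `X_{a₁ … aₙ}^{b₁ … bₙ}`. -/
inductive Bubble (α : Type) : Type
  | star (A : Finset α) : Bubble α
  | gathering (a b : List α) (ha : a.Nodup) (hb : b.Nodup) (hab : ∀ c, c ∈ a ↔ c ∈ b) : Bubble α

namespace Bubble

variable {α : Type}

/-- The language of a star is `A*`. The language of a gathering is the set of all words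
`a₁ w₁ … aₙ wₙ b₁ v₁ … bₙ vₙ` with `wᵢ ∈ {a₁, …, aᵢ}*` and
`vᵢ ∈ ({a₁, …, aₙ} ∖ {b₁, …, bᵢ})*`. -/
def lang : Bubble α → Language α
  | star A => {w | ∀ c ∈ w, c ∈ A}
  | gathering a b _ _ _ =>
      {z | ∃ (w : Fin a.length → List α) (v : Fin b.length → List α),
        (∀ i, ∀ c ∈ w i, c ∈ a.take (i + 1)) ∧
        (∀ i, ∀ c ∈ v i, c ∈ a ∧ c ∉ b.take (i + 1)) ∧
        z = (List.ofFn fun i => a.get i :: w i).flatten ++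
            (List.ofFn fun i => b.get i :: v i).flatten}

/-- The number of letters of a bubble. -/
def size : Bubble α → ℕ
  | star A => A.card
  | gathering a _ _ _ _ => a.length

/-- The bubble is a gathering. -/
def IsGathering : Bubble α → Prop
  | star _ => False
  | gathering _ _ _ _ _ => True

/-- The weight of a bubble with `i` letters is the `i`-th unit vector of `ℕⁿ` (zero if `i = 0`).
The index `j : Fin n` stands for the `(j + 1)`-st component. -/
def weight (n : ℕ) (X : Bubble α) : Fin n → ℕ :=
  fun j => if (j : ℕ) + 1 = X.size then 1 else 0

end Bubble

/-- The path-scheme `u₀ X₁ u₁ … Xₙ uₙ`, with `head = u₀` and `tail = [(X₁, u₁), …, (Xₙ, uₙ)]`. -/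
structure PathScheme (α : Type) : Type where
  head : List α
  tail : List (Bubble α × List α)

namespace PathScheme

variable {α : Type}

/-- The words `u₀ w₁ u₁ … wₙ uₙ` with `wᵢ ∈ L(Xᵢ)`; the product is concatenation. -/
def lang (ρ : PathScheme α) : Language α :=
  ({ρ.head} : Language α) * (ρ.tail.map fun p => p.1.lang * ({p.2} : Language α)).prod

/-- The sum of the weights of the bubbles, a vector in `ℕ^|Σ|`. -/
def weight [Fintype α] (ρ : PathScheme α) : Fin (Fintype.card α) → ℕ :=
  (ρ.tail.map fun p => p.1.weight (Fintype.card α)).sum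

/-- All bubbles are gatherings. -/
def PrePerfect (ρ : PathScheme α) : Prop :=
  ∀ p ∈ ρ.tail, p.1.IsGathering

/-- Pre-perfect, and the language meets the transition language between `x` and `y`. -/
def Perfect {d : ℕ} {S : Finset (Fin d → ℤ)} (x y : CVAS.Conf d) (ρ : PathScheme S) : Prop :=
  ρ.PrePerfect ∧ ∃ w, w ∈ ρ.lang ∧ w ∈ CVAS.lang S x y

end PathScheme

/-- The lexicographic order on `ℕⁿ` in which the last component is the most significant. -/
def LexLE {n : ℕ} (u v : Fin n → ℕ) : Prop :=
  u = v ∨ ∃ i, u i < v i ∧ ∀ j, i < j → u j = v j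

/-! ### Finite descriptions, for computability

An integer vector is written as the list of its entries, a nonnegative rational as a fraction
(numerator, denominator), a word as the list of its letters, and a finite set as any list of its
elements. All these types have the encodings by natural numbers that `Computable` uses. -/

/-- Descriptions of words, and of finite sets of integer vectors. -/
abbrev WordCode : Type := List (List ℤ)

/-- Descriptions of configurations. -/
abbrev ConfCode : Type := List (ℕ × ℕ)

/-- Descriptions of bubbles: the set of a star, or the two sequences of a gathering. -/
abbrev BubbleCode : Type := WordCode ⊕ (WordCode × WordCode)

/-- Descriptions of path-schemes. -/
abbrev PathSchemeCode : Type := WordCode × List (BubbleCode × WordCode)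

/-- Descriptions of a dimension, a system, two configurations and a path-scheme. -/
abbrev InputCode : Type := ℕ × WordCode × ConfCode × ConfCode × PathSchemeCode

section Codes

variable {d : ℕ} {S : Finset (Fin d → ℤ)}

/-- `c` describes the word `w`. -/
def IsWordCode (c : WordCode) (w : List S) : Prop :=
  c = w.map fun t => List.ofFn t.1

/-- `c` lists the elements of `S`, in any order and possibly with repetitions. -/
def IsSystemCode (c : WordCode) (S : Finset (Fin d → ℤ)) : Prop :=
  ∀ l, l ∈ c ↔ ∃ t ∈ S, List.ofFn t = l

/-- `c` describes `x` by fractions, not necessarily in lowest terms. -/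
def IsConfCode (c : ConfCode) (x : CVAS.Conf d) : Prop :=
  List.Forall₂ (fun p q => p.2 ≠ 0 ∧ (q : ℚ≥0) = (p.1 : ℚ≥0) / (p.2 : ℚ≥0)) c (List.ofFn x)

/-- `c` describes the bubble. -/
def IsBubbleCode : BubbleCode → Bubble S → Prop
  | .inl c, .star A => ∀ l, l ∈ c ↔ ∃ t ∈ A, List.ofFn t.1 = l
  | .inr c, .gathering a b _ _ _ => IsWordCode c.1 a ∧ IsWordCode c.2 b
  | _, _ => False

/-- `c` describes the path-scheme `ρ`. -/
def IsPathSchemeCode (c : PathSchemeCode) (ρ : PathScheme S) : Prop :=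
  IsWordCode c.1 ρ.head ∧
    List.Forall₂ (fun p q => IsBubbleCode p.1 q.1 ∧ IsWordCode p.2 q.2) c.2 ρ.tail

/-- `c` describes the dimension `d`, the system `S`, the configurations `x`, `y` and the
path-scheme `ρ`. -/
def IsInputCode (c : InputCode) (S : Finset (Fin d → ℤ)) (x y : CVAS.Conf d)
    (ρ : PathScheme S) : Prop :=
  c.1 = d ∧ IsSystemCode c.2.1 S ∧ IsConfCode c.2.2.1 x ∧ IsConfCode c.2.2.2.1 y ∧
    IsPathSchemeCode c.2.2.2.2 ρ

end Codes

/-! Two facts carry the theorem.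

First, a star is a finite union of products of letters and gatherings, whatever the runs are
(`starSchemes_complete`). Cut a nonempty word at the first position where all its letters have
occurred: w = u c v, with c not in u. If every letter recurs in v, then w lies in the gathering
given by the order of first occurrences in u c and of last occurrences in v. Otherwise u misses c
and v misses some letter, so both are covered by recursion on the number of letters. A gathering of
full size only ever stands alone and all other products use smaller gatherings, so the weight does
not grow (`starSchemes_size`).

Second, whether a gathering has a run from x to y is a linear condition
(`CVAS.exists_reach_gathering_iff`): y - x is a positive combination of its letters, no counter that
is zero at x is first changed by a decrease in the order a, and no counter that is zero at y is last
changed by an increase in the order b. This is necessary because counters stay nonnegative.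
Conversely, fire a at the start and b at the end with tiny fractions. All counters that the letters
change are then positive in between, and the remaining combination is fired by repeating a in many
small rounds.

Hence the configurations from which a star-free scheme leads to y are the solutions of finitely many
strict or weak linear inequalities with integer coefficients, computed backwards from y by
Fourier–Motzkin elimination (`Ineq.forall_foldr_back_iff`). The algorithm enumerates the star-free
schemes and keeps the feasible ones; a discarded scheme contains no word of the transition language.
Everything is primitive recursive on codes, and the enumeration only compares letters for equality,
so it commutes with coding them (`expand_map`). -/

/-! ### Fourier–Motzkin elimination -/

/-- Finitely many lower and upper bounds, each of them strict or not, that are pairwise compatible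
can be met simultaneously. -/
theorem exists_between_bounds (Lo Up : Finset (ℚ × Bool))
    (h : ∀ l ∈ Lo, ∀ u ∈ Up, l.1 ≤ u.1 ∧ (l.2 = true ∨ u.2 = true → l.1 < u.1)) :
    ∃ α : ℚ, (∀ l ∈ Lo, l.1 ≤ α ∧ (l.2 = true → l.1 < α)) ∧
      ∀ u ∈ Up, α ≤ u.1 ∧ (u.2 = true → α < u.1) := by
  rcases Lo.eq_empty_or_nonempty with rfl | hLo
  · rcases Up.eq_empty_or_nonempty with rfl | hUp
    · exact ⟨0, by simp, by simp⟩
    · obtain ⟨u, hu, hmin⟩ := Finset.exists_min_image Up Prod.fst hUp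
      refine ⟨u.1 - 1, by simp, fun v hv => ?_⟩
      have := hmin v hv
      exact ⟨by linarith, fun _ => by linarith⟩
  · obtain ⟨l, hl, hmax⟩ := Finset.exists_max_image Lo Prod.fst hLo
    rcases Up.eq_empty_or_nonempty with rfl | hUp
    · refine ⟨l.1 + 1, fun v hv => ?_, by simp⟩
      have := hmax v hv
      exact ⟨by linarith, fun _ => by linarith⟩
    · obtain ⟨u, hu, hmin⟩ := Finset.exists_min_image Up Prod.fst hUp
      rcases (h l hl u hu).1.lt_or_eq with hlt | heq
      · refine ⟨(l.1 + u.1) / 2, fun v hv => ?_, fun v hv => ?_⟩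
        · have := hmax v hv
          exact ⟨by linarith, fun _ => by linarith⟩
        · have := hmin v hv
          exact ⟨by linarith, fun _ => by linarith⟩
      · refine ⟨l.1, fun v hv => ⟨hmax v hv, fun hs => ?_⟩, fun v hv => ⟨?_, fun hs => ?_⟩⟩
        · rw [heq]; exact (h v hv u hu).2 (Or.inl hs)
        · rw [heq]; exact hmin v hv
        · exact (h l hl v hv).2 (Or.inr hs)

/-- The inequality `k₀ + ∑ kᵢ xᵢ ≥ 0`, strict if the flag is set, is written `(k, k₀, flag)`. -/
abbrev Ineq : Type := List ℤ × ℤ × Bool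

namespace Ineq

/-- `0 ≤ v`, or `0 < v` if the flag is set. -/
def Pos (s : Bool) (v : ℚ) : Prop :=
  0 ≤ v ∧ (s = true → 0 < v)

/-- The value of the left-hand side at `x`. -/
def eval {d : ℕ} (K : Ineq) (x : Fin d → ℚ) : ℚ :=
  ∑ i : Fin d, (K.1.getD i 0 : ℚ) * x i + K.2.1

/-- The inequality holds at `x`. -/
def Holds {d : ℕ} (K : Ineq) (x : Fin d → ℚ) : Prop :=
  Pos K.2.2 (K.eval x)

/-- The scalar product of the first `d` entries. -/
def dot (d : ℕ) (k t : List ℤ) : ℤ :=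
  ((List.range d).map fun i => k.getD i 0 * t.getD i 0).sum

/-- Cancel the eliminated variable, of coefficient `p.1 > 0` in `p` and `q.1 < 0` in `q`. -/
def combine (d : ℕ) (p q : ℤ × Ineq) : Ineq :=
  ((List.range d).map fun i => -q.1 * p.2.1.getD i 0 + p.1 * q.2.1.getD i 0,
    -q.1 * p.2.2.1 + p.1 * q.2.2.1, p.2.2.2 || q.2.2.2)

/-- Elimination of the variable whose coefficients are the first components. -/
def eliminate (d : ℕ) (L : List (ℤ × Ineq)) : List Ineq :=
  L.flatMap fun p => L.flatMap fun q =>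
    if 0 < p.1 ∧ q.1 < 0 then [combine d p q] else if p.1 = 0 then [p.2] else []

theorem dot_eq_sum (d : ℕ) (k t : List ℤ) :
    dot d k t = ∑ i : Fin d, k.getD i 0 * t.getD i 0 := by
  rw [← Finset.sum_range fun i => k.getD i 0 * t.getD i 0]
  rfl

theorem Pos.mul {s : Bool} {v c : ℚ} (h : Pos s v) (hc : 0 < c) : Pos s (c * v) :=
  ⟨mul_nonneg hc.le h.1, fun hs => mul_pos hc (h.2 hs)⟩

theorem Pos.add {s s' : Bool} {v w : ℚ} (h : Pos s v) (h' : Pos s' w) : Pos (s || s') (v + w) := by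
  refine ⟨add_nonneg h.1 h'.1, fun hs => ?_⟩
  rcases Bool.or_eq_true_iff.1 hs with hs | hs
  · exact add_pos_of_pos_of_nonneg (h.2 hs) h'.1
  · exact add_pos_of_nonneg_of_pos h.1 (h'.2 hs)

theorem eval_combine {d : ℕ} (p q : ℤ × Ineq) (x : Fin d → ℚ) :
    (combine d p q).eval x = -q.1 * p.2.eval x + p.1 * q.2.eval x := by
  have h : ∀ i : Fin d, (((combine d p q).1.getD i 0 : ℤ) : ℚ) * x i =
      -q.1 * ((p.2.1.getD i 0 : ℚ) * x i) + p.1 * ((q.2.1.getD i 0 : ℚ) * x i) := by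
    intro i
    have : (combine d p q).1.getD i 0 = -q.1 * p.2.1.getD i 0 + p.1 * q.2.1.getD i 0 := by
      simp [combine]
    rw [this]; push_cast; ring
  simp only [eval, h, Finset.sum_add_distrib, ← Finset.mul_sum]
  simp only [combine]
  push_cast
  ring

/-- Fourier–Motzkin elimination of one variable is correct. -/
theorem forall_eliminate_holds_iff {d : ℕ} (L : List (ℤ × Ineq)) (x : Fin d → ℚ) :
    (∀ K ∈ eliminate d L, K.Holds x) ↔ ∃ α : ℚ, ∀ p ∈ L, Pos p.2.2.2 (p.2.eval x + α * p.1) := by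
  constructor
  · intro h
    have hzero : ∀ p ∈ L, p.1 = 0 → Pos p.2.2.2 (p.2.eval x) := by
      intro p hp h0
      refine h p.2 ?_
      simp only [eliminate, List.mem_flatMap]
      -- An inequality free of the variable is emitted once for each `q`; `q = p` always serves.
      exact ⟨p, hp, p, hp, by simp [h0]⟩
    have hpair : ∀ p ∈ L, ∀ q ∈ L, 0 < p.1 → q.1 < 0 →
        Pos (p.2.2.2 || q.2.2.2) (-q.1 * p.2.eval x + p.1 * q.2.eval x) := by
      intro p hp q hq h1 h2
      rw [← eval_combine]
      refine h (combine d p q) ?_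
      simp only [eliminate, List.mem_flatMap]
      exact ⟨p, hp, q, hq, by simp [h1, h2]⟩
    -- A positive coefficient bounds `α` from below by `-eval / p.1`, a negative one from above; the
    -- flags carry the strictness.
    obtain ⟨α, hlo, hup⟩ := exists_between_bounds
      ((L.filter fun p => 0 < p.1).map fun p => (-p.2.eval x / (p.1 : ℚ), p.2.2.2)).toFinset
      ((L.filter fun p => p.1 < 0).map fun p => (-p.2.eval x / (p.1 : ℚ), p.2.2.2)).toFinset (by
        simp only [List.mem_toFinset, List.mem_map, List.mem_filter, decide_eq_true_eq]
        rintro _ ⟨p, ⟨hp, hp0⟩, rfl⟩ _ ⟨q, ⟨hq, hq0⟩, rfl⟩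
        have hp0' : (0 : ℚ) < p.1 := by exact_mod_cast hp0
        have hq0' : (q.1 : ℚ) < 0 := by exact_mod_cast hq0
        have key := hpair p hp q hq hp0 hq0
        -- The gap between the two bounds is the combined inequality divided by a positive number.
        have e : -q.2.eval x / q.1 - -p.2.eval x / p.1 =
            (-q.1 * p.2.eval x + p.1 * q.2.eval x) / (p.1 * -q.1) := by
          have h1 := hp0'.ne'
          have h2 := hq0'.ne
          field_simp
          ring
        have hden : (0 : ℚ) < p.1 * -q.1 := by nlinarith
        constructor
        · rw [← sub_nonneg, e]
          exact div_nonneg key.1 hden.le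
        · intro hs
          rw [← sub_pos, e]
          exact div_pos (key.2 (by simpa using hs)) hden)
    simp only [List.mem_toFinset, List.mem_map, List.mem_filter, decide_eq_true_eq] at hlo hup
    refine ⟨α, fun p hp => ?_⟩
    rcases lt_trichotomy p.1 0 with hneg | h0 | hpos
    · have hneg' : (p.1 : ℚ) < 0 := by exact_mod_cast hneg
      have := hup _ ⟨p, ⟨hp, hneg⟩, rfl⟩
      simp only [le_div_iff_of_neg hneg', lt_div_iff_of_neg hneg'] at this
      exact ⟨by linarith [this.1], fun hs => by linarith [this.2 hs]⟩
    · simpa [h0] using hzero p hp h0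
    · have hpos' : (0 : ℚ) < p.1 := by exact_mod_cast hpos
      have := hlo _ ⟨p, ⟨hp, hpos⟩, rfl⟩
      simp only [div_le_iff₀ hpos', div_lt_iff₀ hpos'] at this
      exact ⟨by linarith [this.1], fun hs => by linarith [this.2 hs]⟩
  · rintro ⟨α, hα⟩ K hK
    simp only [eliminate, List.mem_flatMap] at hK
    obtain ⟨p, hp, q, hq, hK⟩ := hK
    split_ifs at hK with h1 h2
    · rw [List.mem_singleton] at hK
      subst hK
      have hp0 : (0 : ℚ) < p.1 := by exact_mod_cast h1.1
      have hq0 : (0 : ℚ) < -q.1 := by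
        have : (q.1 : ℚ) < 0 := by exact_mod_cast h1.2
        linarith
      have := ((hα p hp).mul hq0).add ((hα q hq).mul hp0)
      rwa [Holds, eval_combine, show -(q.1 : ℚ) * p.2.eval x + p.1 * q.2.eval x =
        -q.1 * (p.2.eval x + α * p.1) + p.1 * (q.2.eval x + α * q.1) by ring]
    · rw [List.mem_singleton] at hK
      subst hK
      simpa [Holds, h2] using hα p hp
    · simp at hK

/-- Preimage of a solution set under a translation by a multiple of `t`, where `B` restricts the
factor. -/
def preimage (d : ℕ) (B : List (ℤ × Ineq)) (t : List ℤ) (L : List Ineq) : List Ineq :=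
  eliminate d (B ++ L.map fun K => (dot d K.1 t, K))

/-- The factor is positive. -/
def positive : List (ℤ × Ineq) := [(1, [], 0, true)]

/-- The factor is positive and at most one. -/
def fraction : List (ℤ × Ineq) := [(1, [], 0, true), (-1, [], 1, false)]

/-- Along the direction `t` an affine form is affine in the factor, with slope the scalar product.
This slope is the coefficient of the variable that `preimage` eliminates. -/
theorem eval_add_smul {d : ℕ} (K : Ineq) (x : Fin d → ℚ) (α : ℚ) (t : Fin d → ℤ) :
    K.eval (fun i => x i + α * t i) = K.eval x + α * dot d K.1 (List.ofFn t) := by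
  have h : ∀ i : Fin d, (K.1.getD i 0 : ℚ) * (x i + α * t i) =
      (K.1.getD i 0 : ℚ) * x i + α * ((K.1.getD i 0 * (List.ofFn t).getD i 0 : ℤ) : ℚ) := by
    intro i
    have : (List.ofFn t).getD i 0 = t i := by simp
    rw [this]; push_cast; ring
  simp only [eval, h, Finset.sum_add_distrib, ← Finset.mul_sum, dot_eq_sum, Int.cast_sum]
  ring

theorem forall_preimage_holds_iff {d : ℕ} (B : List (ℤ × Ineq)) (t : Fin d → ℤ) (L : List Ineq)
    (x : Fin d → ℚ) :
    (∀ K ∈ preimage d B (List.ofFn t) L, K.Holds x) ↔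
      ∃ α : ℚ, (∀ p ∈ B, Pos p.2.2.2 (p.2.eval x + α * p.1)) ∧
        ∀ K ∈ L, K.Holds fun i => x i + α * t i := by
  rw [preimage, forall_eliminate_holds_iff]
  simp only [List.forall_mem_append, List.forall_mem_map, Holds, eval_add_smul]

/-- The empty coefficient list reads as the zero vector through `getD`, so `x` drops out. -/
theorem forall_positive_iff {d : ℕ} (x : Fin d → ℚ) (α : ℚ) :
    (∀ p ∈ positive, Pos p.2.2.2 (p.2.eval x + α * p.1)) ↔ 0 < α := by
  simp [positive, Pos, eval]
  exact le_of_lt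

theorem forall_fraction_iff {d : ℕ} (x : Fin d → ℚ) (α : ℚ) :
    (∀ p ∈ fraction, Pos p.2.2.2 (p.2.eval x + α * p.1)) ↔ 0 < α ∧ α ≤ 1 := by
  simp [fraction, Pos, eval]
  intro _
  exact le_of_lt

end Ineq

/-! ### Gatherings by first and last occurrences -/

namespace Bubble

variable {α : Type}

/-- `u = a₁ w₁ … aₙ wₙ` with `wᵢ` a word over `Q` and `a₁, …, aᵢ`. -/
def Opening : List α → List α → List α → Prop
  | _, [], u => u = []
  | Q, c :: a, u => ∃ w v, (∀ e ∈ w, e ∈ Q ++ [c]) ∧ Opening (Q ++ [c]) a v ∧ u = c :: (w ++ v)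

/-- `u = b₁ w₁ … bₙ wₙ` with `wᵢ` a word over `bᵢ₊₁, …, bₙ`. -/
def Closing : List α → List α → Prop
  | [], u => u = []
  | c :: b, u => ∃ w v, (∀ e ∈ w, e ∈ b) ∧ Closing b v ∧ u = c :: (w ++ v)

/-- Passage between the recursion and the indexed families of `Bubble.lang`. The letters already
opened accumulate in `Q`, which therefore has to vary in the induction. -/
theorem opening_iff (Q a u : List α) :
    Opening Q a u ↔ ∃ w : Fin a.length → List α, (∀ i, ∀ c ∈ w i, c ∈ Q ++ a.take (i + 1)) ∧
      u = (List.ofFn fun i => a.get i :: w i).flatten := by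
  induction a generalizing Q u with
  | nil => simp [Opening]
  | cons c a ih =>
    simp only [Opening, ih]
    rw [show (∃ w : Fin (c :: a).length → List α,
        (∀ i, ∀ e ∈ w i, e ∈ Q ++ (c :: a).take (i + 1)) ∧
          u = (List.ofFn fun i => (c :: a).get i :: w i).flatten) ↔ _ from
      Fin.exists_fin_succ_pi (n := a.length)]
    constructor
    · rintro ⟨w, v, hw, ⟨w', hw', rfl⟩, rfl⟩
      refine ⟨w, w', fun i => ?_, by simp [List.ofFn_succ]⟩
      cases i using Fin.cases with
      | zero => simpa using hw
      | succ i => simpa using hw' i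
    · rintro ⟨w, w', h, rfl⟩
      refine ⟨w, _, by simpa using h 0, ⟨w', fun i => by simpa using h i.succ, rfl⟩, ?_⟩
      simp [List.ofFn_succ]

/-- Only for repetition-free `b` are the letters outside an initial segment exactly those of the
remaining one. -/
theorem closing_iff {b : List α} (hb : b.Nodup) (u : List α) :
    Closing b u ↔ ∃ w : Fin b.length → List α, (∀ i, ∀ c ∈ w i, c ∈ b ∧ c ∉ b.take (i + 1)) ∧
      u = (List.ofFn fun i => b.get i :: w i).flatten := by
  induction b generalizing u with
  | nil => simp [Closing]
  | cons c b ih =>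
    have hcb := (List.nodup_cons.1 hb).1
    simp only [Closing, ih (List.nodup_cons.1 hb).2]
    rw [show (∃ w : Fin (c :: b).length → List α,
        (∀ i, ∀ e ∈ w i, e ∈ c :: b ∧ e ∉ (c :: b).take (i + 1)) ∧
          u = (List.ofFn fun i => (c :: b).get i :: w i).flatten) ↔ _ from
      Fin.exists_fin_succ_pi (n := b.length)]
    constructor
    · rintro ⟨w, v, hw, ⟨w', hw', rfl⟩, rfl⟩
      refine ⟨w, w', fun i => ?_, by simp [List.ofFn_succ]⟩
      cases i using Fin.cases with
      | zero =>
        intro e he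
        have := hw e he
        simp only [List.mem_cons, this, or_true, true_and]
        simp
        rintro rfl
        exact hcb this
      | succ i =>
        intro e he
        have := hw' i e he
        simp only [List.mem_cons, this, or_true, true_and]
        simp [this]
        rintro rfl
        exact hcb this.1
    · rintro ⟨w, w', h, rfl⟩
      refine ⟨w, _, fun e he => ?_, ⟨w', fun i e he => ?_, rfl⟩, ?_⟩
      · have := h 0 e he
        simp at this
        tauto
      · have := h i.succ e he
        simp at this
        tauto
      · simp [List.ofFn_succ]

variable [DecidableEq α]

/-- `dedup` keeps last occurrences, so on the reversed word it records first occurrences. The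
fillers consist of letters already seen and leave no trace. -/
theorem Opening.dedup {Q a u : List α} (h : Opening Q a u) (hQa : (Q ++ a).Nodup) :
    (u.reverse ++ Q.reverse).dedup = a.reverse ++ Q.reverse := by
  induction a generalizing Q u with
  | nil =>
    obtain rfl : u = [] := h
    simpa [List.dedup_eq_self] using hQa
  | cons c a ih =>
    obtain ⟨w, v, hw, hv, rfl⟩ := h
    have ih := ih hv (by simpa using hQa)
    have hsub : w.reverse ⊆ c :: Q.reverse := fun e he => by
      have := hw e (by simpa using he)
      simpa [or_comm] using this
    simp only [List.reverse_append, List.reverse_cons, List.reverse_nil, List.nil_append,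
      List.append_assoc, List.singleton_append] at ih ⊢
    rw [← ih, List.dedup_append, List.dedup_append v.reverse,
      List.Subset.dedup_append_right hsub]

/-- Every word has an opening: each letter not seen before starts a new block. The prefix `w`
collects what comes before the first new letter. -/
theorem exists_opening (Q u : List α) : ∃ a w v, (∀ e ∈ w, e ∈ Q) ∧ Opening Q a v ∧
    (∀ e ∈ a, e ∉ Q) ∧ a.Nodup ∧ u = w ++ v := by
  induction u generalizing Q with
  | nil => exact ⟨[], [], [], by simp, rfl, by simp, by simp, rfl⟩
  | cons c u ih =>
    by_cases hc : c ∈ Q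
    · obtain ⟨a, w, v, hw, hv, ha, hn, rfl⟩ := ih Q
      exact ⟨a, c :: w, v, by simpa [hc] using hw, hv, ha, hn, rfl⟩
    · obtain ⟨a, w, v, hw, hv, ha, hn, rfl⟩ := ih (Q ++ [c])
      refine ⟨c :: a, [], c :: (w ++ v), by simp, ⟨w, v, hw, hv, rfl⟩, ?_, ?_, rfl⟩
      · rintro e (_ | ⟨_, he⟩)
        · exact hc
        · exact fun h => ha e he (by simp [h])
      · exact List.nodup_cons.2 ⟨fun h => ha c h (by simp), hn⟩

theorem opening_nil_iff {a : List α} (ha : a.Nodup) (u : List α) :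
    Opening [] a u ↔ u.reverse.dedup = a.reverse := by
  constructor
  · intro h
    simpa using h.dedup (by simpa using ha)
  · intro h
    obtain ⟨a', w, v, hw, hv, -, hn, rfl⟩ := exists_opening [] u
    obtain rfl : w = [] := List.eq_nil_iff_forall_not_mem.2 fun e he => by simpa using hw e he
    have := hv.dedup (by simpa using hn)
    simp only [List.reverse_nil, List.append_nil, List.nil_append] at this h
    rw [h, List.reverse_inj] at this
    exact this ▸ hv

theorem Closing.dedup {b u : List α} (h : Closing b u) (hb : b.Nodup) : u.dedup = b := by
  induction b generalizing u with
  | nil =>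
    obtain rfl : u = [] := h
    rfl
  | cons c b ih =>
    obtain ⟨w, v, hw, hv, rfl⟩ := h
    have ih := ih hv (List.nodup_cons.1 hb).2
    have hsub : w ⊆ v := fun e he => by
      rw [← List.mem_dedup, ih]
      exact hw e he
    have hc : c ∉ w ++ v := by
      intro hc
      rw [← List.mem_dedup, List.Subset.dedup_append_right hsub, ih] at hc
      exact (List.nodup_cons.1 hb).1 hc
    rw [List.dedup_cons_of_notMem hc, List.Subset.dedup_append_right hsub, ih]

/-- The prefix `w` ends before the first letter that does not recur; from there on, each last
occurrence starts a block. -/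
theorem exists_closing (u : List α) :
    ∃ w v, (∀ e ∈ w, e ∈ u.dedup) ∧ Closing u.dedup v ∧ u = w ++ v := by
  induction u with
  | nil => exact ⟨[], [], by simp, rfl, rfl⟩
  | cons c u ih =>
    obtain ⟨w, v, hw, hv, hu⟩ := ih
    by_cases hc : c ∈ u
    · refine ⟨c :: w, v, ?_, ?_, ?_⟩
      · rw [List.dedup_cons_of_mem hc]
        rintro e (_ | ⟨_, he⟩)
        · exact List.mem_dedup.2 hc
        · exact hw e he
      · rwa [List.dedup_cons_of_mem hc]
      · rw [hu, List.cons_append]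
    · refine ⟨[], c :: u, by simp, ?_, rfl⟩
      rw [List.dedup_cons_of_notMem hc]
      exact ⟨w, v, hw, hv, by rw [hu]⟩

/-- The words of a gathering are the products of two words, the first with the given order of first
occurrences, the second with the given order of last occurrences. -/
theorem mem_lang_gathering_iff {a b : List α} (ha : a.Nodup) (hb : b.Nodup)
    (hab : ∀ c, c ∈ a ↔ c ∈ b) (z : List α) :
    z ∈ (gathering a b ha hb hab).lang ↔
      ∃ u v, z = u ++ v ∧ u.reverse.dedup = a.reverse ∧ v.dedup = b := by
  have key : z ∈ (gathering a b ha hb hab).lang ↔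
      ∃ u v, z = u ++ v ∧ Opening [] a u ∧ Closing b v := by
    simp only [opening_iff, closing_iff hb]
    constructor
    · rintro ⟨w, v, hw, hv, rfl⟩
      exact ⟨_, _, rfl, ⟨w, by simpa using hw, rfl⟩, ⟨v, by simpa [hab] using hv, rfl⟩⟩
    · rintro ⟨_, _, rfl, ⟨w, hw, rfl⟩, ⟨v, hv, rfl⟩⟩
      exact ⟨w, v, by simpa using hw, by simpa [hab] using hv, rfl⟩
  rw [key]
  constructor
  · rintro ⟨u, v, rfl, hu, hv⟩
    exact ⟨u, v, rfl, (opening_nil_iff ha u).1 hu, hv.dedup hb⟩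
  · rintro ⟨u, v, rfl, hu, rfl⟩
    obtain ⟨v₀, v₁, hv₀, hv₁, rfl⟩ := exists_closing v
    -- The part of `v` before its closing is moved into the opening; it adds no new letters, so the
    -- order of first occurrences is kept.
    refine ⟨u ++ v₀, v₁, by simp, ?_, hv₁⟩
    rw [opening_nil_iff ha, List.reverse_append, List.Subset.dedup_append_right, hu]
    intro e he
    rw [← List.mem_dedup, hu, List.mem_reverse, hab]
    exact hv₀ e (List.mem_reverse.1 he)

end Bubble

/-! ### Reachability along a gathering -/

/-- The last nonzero entry of a list of integers, zero if there is none. -/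
def lastNonzero (l : List ℤ) : ℤ :=
  l.foldr (fun t m => if m = 0 then t else m) 0

theorem lastNonzero_cons (t : ℤ) (l : List ℤ) :
    lastNonzero (t :: l) = if lastNonzero l = 0 then t else lastNonzero l := rfl

theorem lastNonzero_eq_zero_iff (l : List ℤ) : lastNonzero l = 0 ↔ ∀ t ∈ l, t = 0 := by
  induction l with
  | nil => simp [lastNonzero]
  | cons t l ih =>
    rw [lastNonzero_cons, List.forall_mem_cons, ← ih]
    split_ifs with h <;> simp [h]

theorem lastNonzero_append (l m : List ℤ) :
    lastNonzero (l ++ m) = if lastNonzero m = 0 then lastNonzero l else lastNonzero m := by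
  induction l with
  | nil =>
    split_ifs with h
    · simpa [lastNonzero] using h
    · rfl
  | cons t l ih =>
    rw [List.cons_append, lastNonzero_cons, ih, lastNonzero_cons]
    split_ifs <;> simp_all

/-- A deleted entry has a later copy with the same value, so it never decides. Thus the sign of the
last change of a counter depends only on the order of last occurrences. -/
theorem lastNonzero_map_dedup {α : Type} [DecidableEq α] (f : α → ℤ) (l : List α) :
    lastNonzero (l.dedup.map f) = lastNonzero (l.map f) := by
  induction l with
  | nil => rfl
  | cons c l ih =>
    rw [List.map_cons, lastNonzero_cons]
    by_cases hc : c ∈ l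
    · rw [List.dedup_cons_of_mem hc, ih]
      split_ifs with h
      · rw [h, (lastNonzero_eq_zero_iff _).1 h _ (List.mem_map_of_mem hc)]
      · rfl
    · rw [List.dedup_cons_of_notMem hc, List.map_cons, lastNonzero_cons, ih]

/-! ### Runs: necessary conditions, small runs, repetition -/

namespace CVAS

variable {d : ℕ} {S : Finset (Fin d → ℤ)}

theorem reach_append (x y : Conf d) (u v : List S) :
    Reach x (u ++ v) y ↔ ∃ z, Reach x u z ∧ Reach z v y := by
  induction u generalizing x with
  | nil => simp [Reach]
  | cons t u ih =>
    simp only [List.cons_append, Reach, ih]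
    constructor
    · rintro ⟨α, z, h, z', h1, h2⟩
      exact ⟨z', ⟨α, z, h, h1⟩, h2⟩
    · rintro ⟨z', ⟨α, z, h, h1⟩, h2⟩
      exact ⟨α, z, h, z', h1, h2⟩

/-- `P t` is the total fraction with which `t` is fired. -/
theorem Reach.exists_parikh {x y : Conf d} {w : List S} (h : Reach x w y) :
    ∃ P : S → ℚ, (∀ t, 0 ≤ P t) ∧ (∀ t, 0 < P t ↔ t ∈ w) ∧
      ∀ i, (y i : ℚ) = x i + ∑ t : S, P t * t.1 i := by
  induction w generalizing x with
  | nil =>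
    obtain rfl : x = y := h
    exact ⟨0, by simp, by simp, by simp⟩
  | cons s w ih =>
    obtain ⟨α, z, ⟨h0, h1, hz⟩, hw⟩ := h
    obtain ⟨P, hP, hPw, hy⟩ := ih hw
    refine ⟨fun t => P t + if t = s then α else 0, fun t => ?_, fun t => ?_, fun i => ?_⟩
    · have := hP t
      dsimp only
      split_ifs <;> linarith
    · by_cases hts : t = s
      · have := hP t
        simp only [hts, if_true, List.mem_cons, true_or, iff_true]
        rw [hts] at this
        linarith
      · simp [hts, hPw]
    · rw [hy, hz]
      simp only [add_mul, ite_mul, zero_mul, Finset.sum_add_distrib, Finset.sum_ite_eq',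
        Finset.mem_univ, if_true]
      ring

theorem Reach.apply_eq {x y : Conf d} {w : List S} (h : Reach x w y) {i : Fin d}
    (hw : ∀ t ∈ w, t.1 i = 0) : x i = y i := by
  induction w generalizing x with
  | nil => rw [show x = y from h]
  | cons s w ih =>
    obtain ⟨α, z, ⟨-, -, hz⟩, hr⟩ := h
    rw [← ih hr fun t ht => hw t (List.mem_cons_of_mem _ ht)]
    apply NNRat.coe_injective
    simp [hz, hw s]

/-- After the last letter that changes the counter, its value is already `y i = 0`; an increase
would have come from a negative value. -/
theorem Reach.lastNonzero_nonpos {x y : Conf d} {w : List S} (h : Reach x w y) {i : Fin d}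
    (hi : y i = 0) : lastNonzero (w.map fun t => t.1 i) ≤ 0 := by
  induction w generalizing x with
  | nil => simp [lastNonzero]
  | cons s w ih =>
    obtain ⟨α, z, ⟨h0, h1, hz⟩, hw⟩ := h
    rw [List.map_cons, lastNonzero_cons]
    split_ifs with h
    · have hzi := hz i
      rw [hw.apply_eq fun t ht => (lastNonzero_eq_zero_iff _).1 h _ (List.mem_map_of_mem ht), hi,
        NNRat.coe_zero] at hzi
      have hx : (0 : ℚ) ≤ x i := (x i).2
      by_contra! hs
      have hs' : (0 : ℚ) < s.1 i := by exact_mod_cast hs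
      have := mul_pos h0 hs'
      linarith
    · exact ih hw

/-- Until the first letter that changes the counter, its value is `x i = 0`, which admits no
decrease. -/
theorem Reach.lastNonzero_reverse_nonneg {x y : Conf d} {w : List S} (h : Reach x w y) {i : Fin d}
    (hi : x i = 0) : 0 ≤ lastNonzero (w.map fun t => t.1 i).reverse := by
  induction w generalizing x with
  | nil => simp [lastNonzero]
  | cons s w ih =>
    obtain ⟨α, z, ⟨h0, h1, hz⟩, hw⟩ := h
    rw [List.map_cons, List.reverse_cons, lastNonzero_append, lastNonzero_cons]
    simp only [lastNonzero, List.foldr_nil, if_true]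
    split_ifs with h
    · refine ih hw (NNRat.coe_injective ?_)
      rw [hz i, hi, h]
      simp
    · have hz0 : (0 : ℚ) ≤ z i := (z i).2
      by_contra! hs
      have hs' : (s.1 i : ℚ) < 0 := by exact_mod_cast hs
      have := mul_neg_of_pos_of_neg h0 hs'
      have hzi := hz i
      rw [hi, NNRat.coe_zero] at hzi
      linarith

/-- Firing a letter with a small fraction makes every counter positive that the letter changes,
and keeps the others. -/
theorem exists_small_step (x : Conf d) (t : Fin d → ℤ) (h : ∀ i, t i < 0 → 0 < x i) {ε : ℚ}
    (hε : 0 < ε) : ∃ (α : ℚ) (z : Conf d), 0 < α ∧ α ≤ ε ∧ (∀ i, (z i : ℚ) = x i + α * t i) ∧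
      ∀ i, (0 < x i ∨ t i ≠ 0) → 0 < z i := by
  have hex : ∀ i, ∀ᶠ α : ℚ in nhdsWithin 0 (Set.Ioi 0),
      0 ≤ (x i : ℚ) + α * t i ∧ ((0 < x i ∨ t i ≠ 0) → 0 < (x i : ℚ) + α * t i) := by
    intro i
    have hx : (0 : ℚ) ≤ x i := (x i).2
    rcases hx.eq_or_lt with hx0 | hx0
    · have ht : ¬ t i < 0 := fun ht => by
        have : (0 : ℚ) < x i := by exact_mod_cast h i ht
        linarith
      filter_upwards [self_mem_nhdsWithin] with α hα
      have hα : 0 < α := hα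
      have ht' : (0 : ℚ) ≤ t i := by exact_mod_cast not_lt.1 ht
      refine ⟨by positivity, ?_⟩
      rintro (hx1 | ht1)
      · have : (0 : ℚ) < x i := by exact_mod_cast hx1
        linarith
      · have : (0 : ℚ) < t i := by exact_mod_cast lt_of_le_of_ne (not_lt.1 ht) (Ne.symm ht1)
        positivity
    · have hc : Filter.Tendsto (fun α : ℚ => (x i : ℚ) + α * t i) (nhdsWithin 0 (Set.Ioi 0))
          (nhds (x i + 0 * t i)) := by
        apply Filter.Tendsto.mono_left _ nhdsWithin_le_nhds
        exact Continuous.tendsto (by fun_prop) 0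
      filter_upwards [hc.eventually_const_lt (by simpa using hx0 : (0 : ℚ) < x i + 0 * t i)]
        with α hα
      exact ⟨hα.le, fun _ => hα⟩
  -- Each counter allows all sufficiently small positive fractions, and there are finitely many
  -- counters.
  obtain ⟨α, hα, hα0, hαε⟩ := ((Filter.eventually_all.2 hex).and
    (Ioc_mem_nhdsGT hε)).exists
  refine ⟨α, fun i => ⟨x i + α * t i, (hα i).1⟩, hα0, hαε, fun i => rfl, fun i hi => ?_⟩
  exact (hα i).2 hi

/-- A word without an obstruction at `x` can be fired from `x` with small fractions. -/
theorem exists_small_run_from (a : List S) (x : Conf d)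
    (h : ∀ i, lastNonzero (a.map fun t => t.1 i).reverse < 0 → 0 < x i) {ε : ℚ} (hε : 0 < ε)
    (hε1 : ε ≤ 1) :
    ∃ (P : S → ℚ) (z : Conf d), Reach x a z ∧ (∀ t, P t ≤ ε) ∧ (∀ t, t ∉ a → P t = 0) ∧
      (∀ i, (z i : ℚ) = x i + ∑ t : S, P t * t.1 i) ∧
      ∀ i, (0 < x i ∨ ∃ t ∈ a, t.1 i ≠ 0) → 0 < z i := by
  induction a generalizing x ε with
  | nil => exact ⟨0, x, rfl, fun _ => hε.le, by simp, by simp, by simp⟩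
  | cons s a ih =>
    simp only [List.map_cons, List.reverse_cons, lastNonzero_append] at h
    -- Half of `ε` goes to this occurrence and half to the rest, so that the total per letter stays
    -- below `ε` even if `s` recurs.
    obtain ⟨α, z, hα0, hαε, hz, hpos⟩ := exists_small_step x s.1 (fun i hi => h i (by
      simp [lastNonzero, hi.ne, hi])) (half_pos hε)
    obtain ⟨P, z', hr, hP, hPa, hz', hpos'⟩ := ih z (fun i hi => by
      by_cases hs : s.1 i = 0
      · exact hpos i (Or.inl (h i (by simpa [lastNonzero_cons, lastNonzero, hs] using hi)))
      · exact hpos i (Or.inr hs)) (half_pos hε) (by linarith)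
    refine ⟨fun t => P t + if t = s then α else 0, z', ⟨α, z, ⟨hα0, by linarith, hz⟩, hr⟩,
      fun t => ?_, fun t ht => ?_, fun i => ?_, fun i hi => hpos' i ?_⟩
    · have := hP t
      dsimp only
      split_ifs <;> linarith
    · rw [List.mem_cons, not_or] at ht
      simp [ht.1, hPa t ht.2]
    · rw [hz', hz]
      simp only [add_mul, ite_mul, zero_mul, Finset.sum_add_distrib, Finset.sum_ite_eq',
        Finset.mem_univ, if_true]
      ring
    · rcases hi with hi | ⟨t, ht, hti⟩
      · exact Or.inl (hpos i (Or.inl hi))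
      · rcases List.mem_cons.1 ht with rfl | ht
        · exact Or.inl (hpos i (Or.inr hti))
        · exact Or.inr ⟨t, ht, hti⟩

/-- A word without an obstruction at `y` can be fired with small fractions so that it leads
to `y`. -/
theorem exists_small_run_to (b : List S) (y : Conf d)
    (h : ∀ i, 0 < lastNonzero (b.map fun t => t.1 i) → 0 < y i) {ε : ℚ} (hε : 0 < ε)
    (hε1 : ε ≤ 1) :
    ∃ (P : S → ℚ) (z : Conf d), Reach z b y ∧ (∀ t, P t ≤ ε) ∧ (∀ t, t ∉ b → P t = 0) ∧
      (∀ i, (y i : ℚ) = z i + ∑ t : S, P t * t.1 i) ∧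
      ∀ i, (0 < y i ∨ ∃ t ∈ b, t.1 i ≠ 0) → 0 < z i := by
  induction b using List.reverseRecOn generalizing y ε with
  | nil => exact ⟨0, y, rfl, fun _ => hε.le, by simp, by simp, by simp⟩
  | append_singleton b s ih =>
    simp only [List.map_append, List.map_cons, List.map_nil, lastNonzero_append] at h
    -- The run is built backwards from `y`: undoing `s` is a step along `-s`, and increases take the
    -- role of decreases.
    obtain ⟨α, z, hα0, hαε, hz, hpos⟩ := exists_small_step y (-s.1) (fun i hi => h i (by
      have hi : 0 < s.1 i := by simpa using hi
      simp [lastNonzero, hi.ne', hi])) (half_pos hε)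
    obtain ⟨P, z', hr, hP, hPa, hz', hpos'⟩ := ih z (fun i hi => by
      by_cases hs : s.1 i = 0
      · exact hpos i (Or.inl (h i (by simpa [lastNonzero_cons, lastNonzero, hs] using hi)))
      · exact hpos i (Or.inr (by simpa using hs))) (half_pos hε) (by linarith)
    refine ⟨fun t => P t + if t = s then α else 0, z',
      (reach_append _ _ _ _).2 ⟨z, hr, α, y, ⟨hα0, by linarith, fun i => ?_⟩, rfl⟩,
      fun t => ?_, fun t ht => ?_, fun i => ?_, fun i hi => hpos' i ?_⟩
    · rw [hz]
      simp
    · have := hP t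
      dsimp only
      split_ifs <;> linarith
    · rw [List.mem_append, not_or, List.mem_singleton] at ht
      simp [ht.2, hPa t ht.1]
    · have h1 := hz i
      have h2 := hz' i
      simp only [add_mul, ite_mul, zero_mul, Finset.sum_add_distrib, Finset.sum_ite_eq',
        Finset.mem_univ, if_true]
      simp only [Pi.neg_apply, Int.cast_neg] at h1
      linarith
    · rcases hi with hi | ⟨t, ht, hti⟩
      · exact Or.inl (hpos i (Or.inl hi))
      · rcases List.mem_append.1 ht with ht | ht
        · exact Or.inr ⟨t, ht, hti⟩
        · obtain rfl := List.mem_singleton.1 ht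
          exact Or.inl (hpos i (Or.inr (by simpa using hti)))

/-- A counter at least as large as the total variation still to come cannot become negative; this
invariant survives each step. -/
theorem reach_of_sum_abs_le (a : List S) (Q : S → ℚ) (hQ : ∀ t ∈ a, 0 < Q t ∧ Q t ≤ 1)
    (x z : Conf d) (hz : ∀ i, (z i : ℚ) = x i + (a.map fun t => Q t * t.1 i).sum)
    (hx : ∀ i, (a.map fun t => Q t * |(t.1 i : ℚ)|).sum ≤ x i) : Reach x a z := by
  induction a generalizing x with
  | nil =>
    funext i
    apply NNRat.coe_injective
    simpa using (hz i).symm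
  | cons s a ih =>
    simp only [List.map_cons, List.sum_cons] at hz hx
    have hs := hQ s (by simp)
    have hQ' : ∀ t ∈ a, 0 < Q t ∧ Q t ≤ 1 := fun t ht => hQ t (List.mem_cons_of_mem _ ht)
    have hle : ∀ i, (a.map fun t => Q t * |(t.1 i : ℚ)|).sum ≤ x i + Q s * s.1 i := by
      intro i
      have := hx i
      have := mul_le_mul_of_nonneg_left (neg_abs_le (s.1 i : ℚ)) hs.1.le
      linarith
    have hnn : ∀ i, 0 ≤ (a.map fun t => Q t * |(t.1 i : ℚ)|).sum := by
      intro i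
      apply List.sum_nonneg
      simp only [List.mem_map]
      rintro _ ⟨t, ht, rfl⟩
      exact mul_nonneg (hQ' t ht).1.le (abs_nonneg _)
    refine ⟨Q s, fun i => ⟨x i + Q s * s.1 i, (hnn i).trans (hle i)⟩, ⟨hs.1, hs.2, fun i => rfl⟩,
      ih hQ' _ (fun i => ?_) fun i => hle i⟩
    rw [hz, ← add_assoc]
    rfl

/-- The configurations between rounds lie on the segment from `x` to `z`, so each counter stays
above the smaller of its end values, which covers the variation of one round. -/
theorem reach_flatten_replicate (a : List S) (Q : S → ℚ) (hQ : ∀ t ∈ a, 0 < Q t ∧ Q t ≤ 1) (k : ℕ)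
    (x z : Conf d) (hz : ∀ i, (z i : ℚ) = x i + k * (a.map fun t => Q t * t.1 i).sum)
    (hxM : ∀ i, (a.map fun t => Q t * |(t.1 i : ℚ)|).sum ≤ x i)
    (hzM : ∀ i, (a.map fun t => Q t * |(t.1 i : ℚ)|).sum ≤ z i) :
    Reach x (List.replicate k a).flatten z := by
  induction k generalizing x with
  | zero =>
    funext i
    apply NNRat.coe_injective
    simpa using (hz i).symm
  | succ k ih =>
    have hnn : ∀ i, 0 ≤ (a.map fun t => Q t * |(t.1 i : ℚ)|).sum := by
      intro i
      apply List.sum_nonneg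
      simp only [List.mem_map]
      rintro _ ⟨t, ht, rfl⟩
      exact mul_nonneg (hQ t ht).1.le (abs_nonneg _)
    have hle : ∀ i, (a.map fun t => Q t * |(t.1 i : ℚ)|).sum ≤
        x i + (a.map fun t => Q t * t.1 i).sum := by
      intro i
      have h1 := hz i
      have h2 := hxM i
      have h3 := hzM i
      push_cast at h1
      -- If a round increases the counter, compare with `x`; otherwise the later rounds only lower
      -- it, so compare with `z`.
      rcases le_total 0 (a.map fun t => Q t * (t.1 i : ℚ)).sum with h | h
      · linarith
      · have := mul_nonpos_of_nonneg_of_nonpos (Nat.cast_nonneg (α := ℚ) k) h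
        linarith
    rw [List.replicate_succ, List.flatten_cons, reach_append]
    refine ⟨fun i => ⟨x i + (a.map fun t => Q t * t.1 i).sum, (hnn i).trans (hle i)⟩,
      reach_of_sum_abs_le a Q hQ _ _ (fun i => rfl) hxM, ih _ (fun i => ?_) fun i => hle i⟩
    have := hz i
    push_cast at this
    rw [this]
    change _ = ((x i : ℚ) + _) + _
    ring

theorem exists_pos_forall_le (l : List ℚ) (h : ∀ q ∈ l, 0 < q) : ∃ ε, 0 < ε ∧ ∀ q ∈ l, ε ≤ q := by
  induction l with
  | nil => exact ⟨1, one_pos, by simp⟩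
  | cons p l ih =>
    obtain ⟨ε, hε, hl⟩ := ih fun q hq => h q (List.mem_cons_of_mem _ hq)
    refine ⟨min p ε, lt_min (h p (by simp)) hε, fun q hq => ?_⟩
    rcases List.mem_cons.1 hq with rfl | hq
    · exact min_le_left _ _
    · exact (min_le_right _ _).trans (hl q hq)

theorem sum_map_eq_sum_univ {a : List S} (ha : a.Nodup) (f : S → ℚ) (hf : ∀ t, t ∉ a → f t = 0) :
    (a.map f).sum = ∑ t : S, f t := by
  rw [← List.sum_toFinset f ha]
  exact Finset.sum_subset (Finset.subset_univ _) fun t _ ht => hf t (by simpa using ht)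

/-- If all counters changed by `a` are positive at both ends, a positive combination of the letters
is fired by repeating `a`. -/
theorem exists_reach_flatten_replicate {a : List S} (x z : Conf d) (P : S → ℚ)
    (hP : ∀ t ∈ a, 0 < P t) (hz : ∀ i, (z i : ℚ) = x i + (a.map fun t => P t * t.1 i).sum)
    (hx0 : ∀ i, (∃ t ∈ a, t.1 i ≠ 0) → 0 < x i) (hz0 : ∀ i, (∃ t ∈ a, t.1 i ≠ 0) → 0 < z i) :
    ∃ k : ℕ, Reach x (List.replicate k a).flatten z := by
  set M : Fin d → ℚ := fun i => (a.map fun t => P t * |(t.1 i : ℚ)|).sum with hM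
  have hM0 : ∀ i, 0 ≤ M i := by
    intro i
    apply List.sum_nonneg
    simp only [List.mem_map]
    rintro _ ⟨t, ht, rfl⟩
    exact mul_nonneg (hP t ht).le (abs_nonneg _)
  -- The two sums make the variation `M i / k` of a round fit below both ends, the third term makes
  -- the fractions `P t / k` at most one, and the last makes `k` positive. Where a counter is zero,
  -- `M i` vanishes too.
  obtain ⟨k, hk⟩ := exists_nat_ge (∑ i, M i / x i + ∑ i, M i / z i + (a.map P).sum + 1)
  have h1 : 0 ≤ ∑ i, M i / (x i : ℚ) :=
    Finset.sum_nonneg fun i _ => div_nonneg (hM0 i) (x i).2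
  have h2 : 0 ≤ ∑ i, M i / (z i : ℚ) :=
    Finset.sum_nonneg fun i _ => div_nonneg (hM0 i) (z i).2
  have h3 : 0 ≤ (a.map P).sum := List.sum_nonneg (by
    simp only [List.mem_map]
    rintro _ ⟨t, ht, rfl⟩
    exact (hP t ht).le)
  have hk0 : (0 : ℚ) < k := by linarith
  have hsum : ∀ (f : S → ℚ), (a.map fun t => P t / k * f t).sum =
      (a.map fun t => P t * f t).sum / k := by
    intro f
    rw [div_eq_mul_inv, ← List.sum_map_mul_right]
    congr 1
    refine List.map_congr_left fun t _ => ?_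
    ring
  have hbound : ∀ (v : Conf d), (∀ i, (∃ t ∈ a, t.1 i ≠ 0) → 0 < v i) →
      ∑ i, M i / (v i : ℚ) ≤ k → ∀ i, M i / k ≤ v i := by
    intro v hv hvk i
    by_cases hi : ∃ t ∈ a, t.1 i ≠ 0
    · have hvi : (0 : ℚ) < v i := by exact_mod_cast hv i hi
      have := Finset.single_le_sum (f := fun i => M i / (v i : ℚ))
        (fun i _ => div_nonneg (hM0 i) (v i).2) (Finset.mem_univ i)
      rw [div_le_iff₀ hk0, mul_comm, ← div_le_iff₀ hvi]
      exact this.trans hvk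
    · push Not at hi
      have : M i = 0 := by
        rw [hM]
        apply List.sum_eq_zero
        simp only [List.mem_map]
        rintro _ ⟨t, ht, rfl⟩
        simp [hi t ht]
      rw [this, zero_div]
      exact (v i).2
  refine ⟨k, reach_flatten_replicate a (fun t => P t / k) (fun t ht => ⟨div_pos (hP t ht) hk0, ?_⟩)
    k x z (fun i => ?_) (fun i => ?_) fun i => ?_⟩
  · rw [div_le_one hk0]
    have := List.single_le_sum (l := a.map P) (by
      simp only [List.mem_map]
      rintro _ ⟨t, ht, rfl⟩
      exact (hP t ht).le) _ (List.mem_map_of_mem ht)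
    linarith
  · rw [hsum, hz, mul_div_cancel₀ _ hk0.ne']
  · rw [hsum]
    exact hbound x hx0 (by linarith) i
  · rw [hsum]
    exact hbound z hz0 (by linarith) i

/-- A gathering leads from `x` to `y` if and only if its opening is not obstructed at `x`, its
closing is not obstructed at `y`, and `y - x` is a positive combination of its letters. -/
theorem exists_reach_gathering_iff {a b : List S} (ha : a.Nodup) (hb : b.Nodup)
    (hab : ∀ c, c ∈ a ↔ c ∈ b) (x y : Conf d) :
    (∃ w ∈ (Bubble.gathering a b ha hb hab).lang, Reach x w y) ↔
      (∀ i, lastNonzero (a.map fun t => t.1 i).reverse < 0 → 0 < x i) ∧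
      (∀ i, 0 < lastNonzero (b.map fun t => t.1 i) → 0 < y i) ∧
      ∃ P : S → ℚ, (∀ t ∈ a, 0 < P t) ∧
        ∀ i, (y i : ℚ) = x i + (a.map fun t => P t * t.1 i).sum := by
  constructor
  · rintro ⟨w, hw, hr⟩
    obtain ⟨P, hP, hPw, hy⟩ := hr.exists_parikh
    obtain ⟨u, v, rfl, hu, hv⟩ := (Bubble.mem_lang_gathering_iff ha hb hab w).1 hw
    have hmu : ∀ t, t ∈ u ↔ t ∈ a := fun t => by
      rw [← List.mem_reverse, ← List.mem_dedup, hu, List.mem_reverse]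
    have hmv : ∀ t, t ∈ v ↔ t ∈ a := fun t => by
      rw [← List.mem_dedup, hv, hab]
    have hmem : ∀ t, t ∈ u ++ v ↔ t ∈ a := fun t => by
      rw [List.mem_append, hmu, hmv, or_self]
    obtain ⟨m, hxm, hmy⟩ := (reach_append _ _ _ _).1 hr
    refine ⟨fun i hi => ?_, fun i hi => ?_, P, fun t ht => (hPw t).2 ((hmem t).2 ht), fun i => ?_⟩
    · rw [← List.map_reverse, ← hu, lastNonzero_map_dedup, List.map_reverse] at hi
      by_contra! h0
      exact absurd (hxm.lastNonzero_reverse_nonneg (le_antisymm h0 zero_le)) (not_le.2 hi)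
    · rw [← hv, lastNonzero_map_dedup] at hi
      by_contra! h0
      exact absurd (hmy.lastNonzero_nonpos (le_antisymm h0 zero_le)) (not_le.2 hi)
    · rw [hy, sum_map_eq_sum_univ ha]
      intro t ht
      have : ¬ 0 < P t := by rwa [hPw, hmem]
      rw [le_antisymm (not_lt.1 this) (hP t), zero_mul]
  · rintro ⟨hx, hy, P, hP, hxy⟩
    -- The two small runs use at most a third of `P t` each, which leaves a positive amount for the
    -- rounds in between.
    obtain ⟨ε, hε, hle⟩ := exists_pos_forall_le (1 :: a.map fun t => P t / 3) (by
      simp only [List.mem_cons, List.mem_map]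
      rintro _ (rfl | ⟨t, ht, rfl⟩)
      · exact one_pos
      · exact div_pos (hP t ht) three_pos)
    have hε1 : ε ≤ 1 := hle 1 (by simp)
    have hεP : ∀ t ∈ a, ε ≤ P t / 3 := fun t ht =>
      hle _ (List.mem_cons_of_mem _ (List.mem_map.2 ⟨t, ht, rfl⟩))
    obtain ⟨P₁, x', hr₁, hP₁, hP₁a, hx', hpos₁⟩ := exists_small_run_from a x hx hε hε1
    obtain ⟨P₂, y', hr₂, hP₂, hP₂a, hy', hpos₂⟩ := exists_small_run_to b y hy hε hε1
    obtain ⟨k, hr⟩ := exists_reach_flatten_replicate (a := a) x' y'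
      (fun t => P t - P₁ t - P₂ t) (fun t ht => by linarith [hεP t ht, hP₁ t, hP₂ t])
      (fun i => by
        have h1 := sum_map_eq_sum_univ ha (fun t => P₁ t * t.1 i) fun t ht => by simp [hP₁a t ht]
        have h2 := sum_map_eq_sum_univ ha (fun t => P₂ t * t.1 i) fun t ht => by
          simp [hP₂a t (by rwa [← hab])]
        have h3 : ∀ l : List S, (l.map fun t => (P t - P₁ t - P₂ t) * (t.1 i : ℚ)).sum =
            (l.map fun t => P t * (t.1 i : ℚ)).sum - (l.map fun t => P₁ t * (t.1 i : ℚ)).sum -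
              (l.map fun t => P₂ t * (t.1 i : ℚ)).sum := by
          intro l
          induction l with
          | nil => simp
          | cons t l ih =>
            simp only [List.map_cons, List.sum_cons, ih]
            ring
        rw [h3]
        linarith [hx' i, hy' i, hxy i])
      (fun i hi => hpos₁ i (Or.inr hi))
      (fun i ⟨t, ht, hti⟩ => hpos₂ i (Or.inr ⟨t, (hab t).1 ht, hti⟩))
    -- The first factor has first occurrences in the order `a`, because the repetitions add no
    -- letters; the second has last occurrences in the order `b`.
    refine ⟨(a ++ (List.replicate k a).flatten) ++ b,
      (Bubble.mem_lang_gathering_iff ha hb hab _).2 ⟨_, _, rfl, ?_, hb.dedup⟩,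
      (reach_append _ _ _ _).2 ⟨y', (reach_append _ _ _ _).2 ⟨x', hr₁, hr⟩, hr₂⟩⟩
    rw [List.reverse_append, List.Subset.dedup_append_right, (List.nodup_reverse.2 ha).dedup]
    intro t ht
    simp only [List.mem_reverse, List.mem_flatten, List.mem_replicate] at ht ⊢
    obtain ⟨_, ⟨-, rfl⟩, ht⟩ := ht
    exact ht

end CVAS

/-! ### Decomposition of stars into gatherings -/

theorem LexLE.refl {n : ℕ} (u : Fin n → ℕ) : LexLE u u := Or.inl rfl

/-- The larger of the two deciding indices decides the sum. Hence weights can be compared bubble by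
bubble. -/
theorem LexLE.add {n : ℕ} {u u' v v' : Fin n → ℕ} (h : LexLE u u') (h' : LexLE v v') :
    LexLE (u + v) (u' + v') := by
  rcases h with rfl | ⟨i, hi, hi'⟩ <;> rcases h' with rfl | ⟨j, hj, hj'⟩
  · exact Or.inl rfl
  · exact Or.inr ⟨j, by simpa using hj, fun k hk => by simp [hj' k hk]⟩
  · exact Or.inr ⟨i, by simpa using hi, fun k hk => by simp [hi' k hk]⟩
  · rcases lt_trichotomy i j with hij | rfl | hij
    · exact Or.inr ⟨j, by simpa [hi' j hij] using hj, fun k hk => by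
        simp [hj' k hk, hi' k (hij.trans hk)]⟩
    · exact Or.inr ⟨i, by simpa using add_lt_add hi hj, fun k hk => by simp [hj' k hk, hi' k hk]⟩
    · exact Or.inr ⟨i, by simpa [hj' i hij] using hi, fun k hk => by
        simp [hi' k hk, hj' k (hij.trans hk)]⟩

theorem Language.mem_singleton_iff {α : Type} {w u : List α} : w ∈ ({u} : Language α) ↔ w = u :=
  Iff.rfl

theorem Language.singleton_mul_singleton {α : Type} (u v : List α) :
    ({u} : Language α) * {v} = {u ++ v} := by
  ext w
  simp [Language.mem_mul, Language.mem_singleton_iff, eq_comm]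

/-- A letter, or the two sequences of a gathering. -/
abbrev Atom (α : Type) : Type := α ⊕ (List α × List α)

/-- A bubble with its letters listed. -/
abbrev RawBubble (α : Type) : Type := List α ⊕ (List α × List α)

/-- A path-scheme with the letters of its bubbles listed. -/
abbrev RawScheme (α : Type) : Type := List α × List (RawBubble α × List α)

section Expand

variable {α : Type} [DecidableEq α]

/-- The repetition-free lists of length `k` with entries from `A`. -/
def nodupLists (A : List α) : ℕ → List (List α)
  | 0 => [[]]
  | k + 1 => (nodupLists A k).flatMap fun l => A.flatMap fun c => if c ∈ l then [] else [c :: l]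

/-- The gatherings with `k` letters from `A`. -/
def gatherings (A : List α) (k : ℕ) : List (List (Atom α)) :=
  (nodupLists A k).flatMap fun a => (nodupLists A k).flatMap fun b =>
    if ∀ c ∈ a, c ∈ b then [[Sum.inr (a, b)]] else []

/-- Path-schemes without stars that cover the words over `A` with at most `k` different letters. -/
def starSchemes (A : List α) : ℕ → List (List (Atom α))
  | 0 => [[]]
  | k + 1 => starSchemes A k ++ (gatherings A (k + 1) ++
      (starSchemes A k).flatMap fun s => (starSchemes A k).flatMap fun s' =>
        A.map fun c => s ++ Sum.inl c :: s')

/-- Decomposition of a bubble. -/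
def expandBubble : RawBubble α → List (List (Atom α))
  | .inl A => starSchemes A.dedup A.dedup.length
  | .inr p => [[Sum.inr p]]

/-- Decomposition of `X₁ u₁ … Xₙ uₙ`. -/
def expandTail (l : List (RawBubble α × List α)) : List (List (Atom α)) :=
  l.foldr (fun p L => (expandBubble p.1).flatMap fun s => L.map fun r => s ++ (p.2.map Sum.inl ++ r))
    [[]]

/-- Decomposition of a path-scheme. -/
def expand (c : RawScheme α) : List (List (Atom α)) :=
  (expandTail c.2).map fun s => c.1.map Sum.inl ++ s

theorem mem_nodupLists_iff (A : List α) (k : ℕ) (l : List α) :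
    l ∈ nodupLists A k ↔ l.Nodup ∧ l.length = k ∧ ∀ c ∈ l, c ∈ A := by
  induction k generalizing l with
  | zero =>
    simp only [nodupLists, List.mem_singleton, List.length_eq_zero_iff]
    constructor
    · rintro rfl
      simp
    · exact fun h => h.2.1
  | succ k ih =>
    simp only [nodupLists, List.mem_flatMap, ih]
    constructor
    · rintro ⟨l', ⟨h1, rfl, h3⟩, c, hc, hl⟩
      split_ifs at hl with h
      · simp at hl
      · obtain rfl := List.mem_singleton.1 hl
        exact ⟨List.nodup_cons.2 ⟨h, h1⟩, rfl, List.forall_mem_cons.2 ⟨hc, h3⟩⟩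
    · rintro ⟨h1, h2, h3⟩
      cases l with
      | nil => simp at h2
      | cons c l =>
        rw [List.nodup_cons] at h1
        rw [List.forall_mem_cons] at h3
        exact ⟨l, ⟨h1.2, by simpa using h2, h3.2⟩, c, h3.1, by simp [h1.1]⟩

theorem mem_gatherings_iff (A : List α) (k : ℕ) (s : List (Atom α)) :
    s ∈ gatherings A k ↔ ∃ a b : List α, s = [Sum.inr (a, b)] ∧ a.Nodup ∧ b.Nodup ∧
      (∀ c, c ∈ a ↔ c ∈ b) ∧ a.length = k ∧ ∀ c ∈ a, c ∈ A := by
  simp only [gatherings, List.mem_flatMap, mem_nodupLists_iff]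
  constructor
  · rintro ⟨a, ⟨ha, hk, hA⟩, b, ⟨hb, hk', hA'⟩, h⟩
    split_ifs at h with hab
    · obtain rfl := List.mem_singleton.1 h
      -- One inclusion is enough, since both lists are repetition-free of the same length.
      have : a.Perm b := (List.subperm_of_subset ha hab).perm_of_length_le (by omega)
      exact ⟨a, b, rfl, ha, hb, fun c => this.mem_iff, hk, hA⟩
    · simp at h
  · rintro ⟨a, b, rfl, ha, hb, hab, rfl, hA⟩
    have : b.length = a.length := ((List.perm_ext_iff_of_nodup ha hb).2 hab).length_eq.symm
    exact ⟨a, ⟨ha, rfl, hA⟩, b, ⟨hb, this, fun c hc => hA c ((hab c).2 hc)⟩, by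
      rw [if_pos fun c hc => (hab c).1 hc]; simp⟩

/-! ### Sequences of letters and gatherings as path-schemes -/

namespace Atom

/-- The two sequences are repetition-free and have the same entries. -/
def Valid : Atom α → Prop
  | .inl _ => True
  | .inr p => p.1.Nodup ∧ p.2.Nodup ∧ ∀ c, c ∈ p.1 ↔ c ∈ p.2

open Classical in
/-- The gathering given by two sequences; meaningful for valid pairs only. -/
noncomputable def bubble (p : List α × List α) : Bubble α :=
  if h : p.1.Nodup ∧ p.2.Nodup ∧ ∀ c, c ∈ p.1 ↔ c ∈ p.2 then
    .gathering p.1 p.2 h.1 h.2.1 h.2.2 else .star ∅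

theorem bubble_eq {a b : List α} (ha : a.Nodup) (hb : b.Nodup) (hab : ∀ c, c ∈ a ↔ c ∈ b) :
    bubble (a, b) = .gathering a b ha hb hab :=
  dif_pos (⟨ha, hb, hab⟩ : (a, b).1.Nodup ∧ (a, b).2.Nodup ∧ ∀ c, c ∈ (a, b).1 ↔ c ∈ (a, b).2)

/-- The language of a letter or gathering. -/
noncomputable def lang : Atom α → Language α
  | .inl t => {[t]}
  | .inr p => (bubble p).lang

/-- The weight of a letter or gathering. -/
noncomputable def weight (n : ℕ) : Atom α → Fin n → ℕ
  | .inl _ => 0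
  | .inr p => (bubble p).weight n

/-- The language of a sequence of letters and gatherings. -/
noncomputable def seqLang (s : List (Atom α)) : Language α := (s.map lang).prod

/-- The weight of a sequence of letters and gatherings. -/
noncomputable def seqWeight (n : ℕ) (s : List (Atom α)) : Fin n → ℕ := (s.map (weight n)).sum

theorem seqLang_append (s s' : List (Atom α)) : seqLang (s ++ s') = seqLang s * seqLang s' := by
  simp [seqLang]

theorem seqLang_map_inl (u : List α) : seqLang (u.map Sum.inl) = {u} := by
  induction u with
  | nil => rfl
  | cons t u ih =>
    rw [List.map_cons, ← List.singleton_append, seqLang_append, ih]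
    simp [seqLang, lang, Language.singleton_mul_singleton]

theorem seqWeight_append (n : ℕ) (s s' : List (Atom α)) :
    seqWeight n (s ++ s') = seqWeight n s + seqWeight n s' := by
  simp [seqWeight]

theorem seqWeight_map_inl (n : ℕ) (u : List α) :
    seqWeight n (u.map (Sum.inl : α → Atom α)) = 0 := by
  induction u with
  | nil => rfl
  | cons t u ih => simpa [seqWeight, weight] using ih

/-- The path-scheme given by a sequence of letters and gatherings. -/
noncomputable def toScheme : List (Atom α) → PathScheme α
  | [] => ⟨[], []⟩
  | .inl t :: s => ⟨t :: (toScheme s).head, (toScheme s).tail⟩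
  | .inr p :: s => ⟨[], (bubble p, (toScheme s).head) :: (toScheme s).tail⟩

theorem lang_toScheme (s : List (Atom α)) : (toScheme s).lang = seqLang s := by
  induction s with
  | nil => simp [toScheme, PathScheme.lang, seqLang]; rfl
  | cons x s ih =>
    rw [← List.singleton_append, seqLang_append, ← ih, List.singleton_append]
    rcases x with t | p
    · simp [toScheme, PathScheme.lang, seqLang, lang, ← mul_assoc,
        Language.singleton_mul_singleton]
    · have h : ({[]} : Language α) = 1 := rfl
      simp [toScheme, PathScheme.lang, seqLang, lang, ← mul_assoc, h]

theorem weight_toScheme [Fintype α] (s : List (Atom α)) :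
    (toScheme s).weight = seqWeight (Fintype.card α) s := by
  induction s with
  | nil => rfl
  | cons x s ih =>
    rw [← List.singleton_append, seqWeight_append, ← ih]
    rcases x with t | p <;> simp [toScheme, PathScheme.weight, seqWeight, weight]

theorem prePerfect_toScheme {s : List (Atom α)} (hs : ∀ x ∈ s, Valid x) :
    (toScheme s).PrePerfect := by
  induction s with
  | nil => simp [toScheme, PathScheme.PrePerfect]
  | cons x s ih =>
    rw [List.forall_mem_cons] at hs
    rcases x with t | p
    · exact ih hs.2
    · intro q hq
      rcases List.mem_cons.1 hq with rfl | hq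
      · obtain ⟨ha, hb, hab⟩ := hs.1
        show (bubble (p.1, p.2)).IsGathering
        rw [bubble_eq ha hb hab]
        trivial
      · exact ih hs.2 q hq

end Atom

/-! ### Covering a star without increasing the weight -/

open Atom

theorem starSchemes_valid (A : List α) (k : ℕ) :
    ∀ s ∈ starSchemes A k, ∀ x ∈ s, x.Valid := by
  induction k with
  | zero => simp [starSchemes]
  | succ k ih =>
    simp only [starSchemes, List.mem_append, List.mem_flatMap, List.mem_map, mem_gatherings_iff]
    rintro s (hs | ⟨a, b, rfl, ha, hb, hab, -⟩ | ⟨s₁, h₁, s₂, h₂, c, hc, rfl⟩) x hx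
    · exact ih s hs x hx
    · obtain rfl := List.mem_singleton.1 hx
      exact ⟨ha, hb, hab⟩
    · rcases List.mem_append.1 hx with hx | hx
      · exact ih _ h₁ x hx
      · rcases List.mem_cons.1 hx with rfl | hx
        · trivial
        · exact ih _ h₂ x hx

theorem starSchemes_sound (A : List α) (k : ℕ) :
    ∀ s ∈ starSchemes A k, ∀ w ∈ seqLang s, ∀ c ∈ w, c ∈ A := by
  induction k with
  | zero =>
    simp only [starSchemes, List.mem_singleton]
    rintro _ rfl w hw
    obtain rfl : w = [] := hw
    simp
  | succ k ih =>
    simp only [starSchemes, List.mem_append, List.mem_flatMap, List.mem_map, mem_gatherings_iff]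
    rintro s (hs | ⟨a, b, rfl, ha, hb, hab, -, hA⟩ | ⟨s₁, h₁, s₂, h₂, c, hc, rfl⟩) w hw
    · exact ih s hs w hw
    · simp only [seqLang, lang, List.map_cons, List.map_nil, List.prod_singleton,
        bubble_eq ha hb hab] at hw
      obtain ⟨u, v, rfl, hu, rfl⟩ := (Bubble.mem_lang_gathering_iff ha hb hab w).1 hw
      intro e he
      rcases List.mem_append.1 he with he | he
      · refine hA e ?_
        rwa [← List.mem_reverse, ← hu, List.mem_dedup, List.mem_reverse]
      · exact hA e ((hab e).2 (List.mem_dedup.2 he))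
    · rw [← List.singleton_append, seqLang_append, seqLang_append, Language.mem_mul] at hw
      obtain ⟨w₁, hw₁, w', hw', rfl⟩ := hw
      obtain ⟨w₀, hw₀, w₂, hw₂, rfl⟩ := Language.mem_mul.1 hw'
      obtain rfl : w₀ = [c] := by
        simpa [seqLang, lang, Language.mem_singleton_iff] using hw₀
      intro e he
      simp only [List.mem_append, List.mem_singleton] at he
      rcases he with he | rfl | he
      · exact ih _ h₁ _ hw₁ e he
      · exact hc
      · exact ih _ h₂ _ hw₂ e he

/-- A nonempty word splits at the first position where all its letters have occurred. -/
theorem exists_eq_append_cons_of_ne_nil (w : List α) (hw : w ≠ []) :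
    ∃ u c v, w = u ++ c :: v ∧ c ∉ u ∧ ∀ e ∈ w, e ∈ u ++ [c] := by
  induction w using List.reverseRecOn with
  | nil => exact absurd rfl hw
  | append_singleton w e ih =>
    by_cases he : e ∈ w
    · obtain ⟨u, c, v, hw', hc, hall⟩ := ih (List.ne_nil_of_mem he)
      refine ⟨u, c, v ++ [e], by rw [hw']; simp, hc, fun e' he' => ?_⟩
      rcases List.mem_append.1 he' with he' | he'
      · exact hall e' he'
      · obtain rfl := List.mem_singleton.1 he'
        exact hall _ he
    · exact ⟨w, e, [], rfl, he, fun e' he' => he'⟩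

/-- Induction on the number of different letters, by cutting at the letter that completes the
alphabet of the word. -/
theorem starSchemes_complete (A : List α) (k : ℕ) (w : List α) (hA : ∀ c ∈ w, c ∈ A)
    (hk : w.toFinset.card ≤ k) : ∃ s ∈ starSchemes A k, w ∈ seqLang s := by
  induction k generalizing w with
  | zero =>
    obtain rfl : w = [] := by simpa using hk
    exact ⟨[], by simp [starSchemes], rfl⟩
  | succ k ih =>
    rcases Nat.lt_or_ge k w.toFinset.card with hlt | hle
    · have hw : w ≠ [] := by
        rintro rfl
        simp at hlt
      have hcard : w.toFinset.card = k + 1 := by omega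
      obtain ⟨u, c, v, rfl, hc, hall⟩ := exists_eq_append_cons_of_ne_nil w hw
      simp only [starSchemes, List.mem_append, List.mem_flatMap, List.mem_map, mem_gatherings_iff]
      -- If all letters recur after the cut, the word belongs to one gathering of size `k + 1`.
      -- Otherwise `u` lacks `c` and `v` lacks some letter, so both have at most `k` different
      -- letters.
      by_cases hv : ∀ e ∈ u ++ c :: v, e ∈ v
      · have hu : ∀ e, e ∈ u ++ [c] ↔ e ∈ v := fun e =>
          ⟨fun he => hv e (by simp at he ⊢; tauto), fun he => hall e (by simp [he])⟩
        have hnd : (u ++ [c]).reverse.dedup.reverse.Nodup :=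
          List.nodup_reverse.2 (List.nodup_dedup _)
        have hiff : ∀ e, e ∈ (u ++ [c]).reverse.dedup.reverse ↔ e ∈ v.dedup := fun e => by
          rw [List.mem_reverse, List.mem_dedup, List.mem_reverse, List.mem_dedup, hu]
        refine ⟨_, Or.inr (Or.inl ⟨_, _, rfl, hnd, v.nodup_dedup, hiff, ?_, fun e he => ?_⟩), ?_⟩
        · rw [← hcard, List.length_reverse, ← List.card_toFinset]
          congr 1
          ext e
          simp only [List.mem_toFinset, List.mem_reverse]
          exact ⟨fun he => by simp at he ⊢; tauto, fun he => hall e he⟩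
        · rw [List.mem_reverse, List.mem_dedup, List.mem_reverse, hu] at he
          exact hA e (by simp [he])
        · simp only [seqLang, lang, List.map_cons, List.map_nil, List.prod_singleton,
            bubble_eq hnd v.nodup_dedup hiff]
          exact (Bubble.mem_lang_gathering_iff _ _ _ _).2 ⟨u ++ [c], v, by simp, by simp, rfl⟩
      · push Not at hv
        obtain ⟨e, he, hev⟩ := hv
        have hu : u.toFinset.card ≤ k := by
          rw [← Nat.lt_succ_iff, ← Nat.add_one, ← hcard]
          refine Finset.card_lt_card (Finset.ssubset_iff_of_subset (fun e he => ?_) |>.2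
            ⟨c, by simp, by simpa using hc⟩)
          simp at he ⊢
          tauto
        have hv : v.toFinset.card ≤ k := by
          rw [← Nat.lt_succ_iff, ← Nat.add_one, ← hcard]
          refine Finset.card_lt_card (Finset.ssubset_iff_of_subset (fun e he => ?_) |>.2
            ⟨e, List.mem_toFinset.2 he, by simpa using hev⟩)
          simp at he ⊢
          tauto
        obtain ⟨s₁, h₁, hw₁⟩ := ih u (fun c hc => hA c (by simp [hc])) hu
        obtain ⟨s₂, h₂, hw₂⟩ := ih v (fun c hc => hA c (by simp [hc])) hv
        refine ⟨_, Or.inr (Or.inr ⟨s₁, h₁, s₂, h₂, c, hA c (by simp), rfl⟩), ?_⟩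
        rw [← List.singleton_append, seqLang_append, seqLang_append,
          ← List.singleton_append (l := v)]
        refine Language.append_mem_mul hw₁ (Language.append_mem_mul ?_ hw₂)
        simp [seqLang, lang, Language.mem_singleton_iff]
    · obtain ⟨s, hs, hw⟩ := ih w hA hle
      exact ⟨s, by simp [starSchemes, hs], hw⟩

/-- Concatenation only happens between schemes of the previous level, so a gathering of full size
has no companions. This drives the comparison of weights. -/
theorem starSchemes_size (A : List α) (k : ℕ) : ∀ s ∈ starSchemes A k,
    (∀ p, Sum.inr p ∈ s → p.1.length < k) ∨ ∃ p, s = [Sum.inr p] ∧ p.1.length = k := by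
  induction k with
  | zero => simp [starSchemes]
  | succ k ih =>
    have ih' : ∀ s ∈ starSchemes A k, ∀ p, Sum.inr p ∈ s → p.1.length < k + 1 := by
      intro s hs p hp
      rcases ih s hs with h | ⟨q, rfl, hq⟩
      · exact (h p hp).trans k.lt_succ_self
      · obtain rfl : p = q := by simpa using hp
        omega
    simp only [starSchemes, List.mem_append, List.mem_flatMap, List.mem_map, mem_gatherings_iff]
    rintro s (hs | ⟨a, b, rfl, ha, hb, hab, hk, hA⟩ | ⟨s₁, h₁, s₂, h₂, c, hc, rfl⟩)
    · exact Or.inl (ih' s hs)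
    · exact Or.inr ⟨_, rfl, hk⟩
    · refine Or.inl fun p hp => ?_
      simp only [List.mem_append, List.mem_cons, reduceCtorEq, false_or] at hp
      exact hp.elim (ih' _ h₁ p) (ih' _ h₂ p)

theorem weight_bubble_of_valid {n : ℕ} {p : List α × List α} (h : Atom.Valid (Sum.inr p))
    (j : Fin n) : (bubble p).weight n j = if (j : ℕ) + 1 = p.1.length then 1 else 0 := by
  obtain ⟨ha, hb, hab⟩ := h
  rw [show bubble p = _ from bubble_eq ha hb hab]
  rfl

theorem seqWeight_apply_eq_zero {n : ℕ} {s : List (Atom α)} (hs : ∀ x ∈ s, x.Valid) (j : Fin n)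
    (h : ∀ p, Sum.inr p ∈ s → p.1.length ≠ j + 1) : seqWeight n s j = 0 := by
  induction s with
  | nil => rfl
  | cons x s ih =>
    rw [List.forall_mem_cons] at hs
    rw [← List.singleton_append, seqWeight_append, Pi.add_apply,
      ih hs.2 fun p hp => h p (List.mem_cons_of_mem _ hp)]
    rcases x with t | p
    · simp [seqWeight, weight]
    · simp [seqWeight, weight, weight_bubble_of_valid hs.1, (h p (by simp)).symm]

theorem Bubble.weight_star {α : Type} {n : ℕ} (B : Finset α) (j : Fin n) :
    (Bubble.star B).weight n j = if (j : ℕ) + 1 = B.card then 1 else 0 := rfl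

/-- A lone gathering of full size weighs as much as the star. Otherwise the component for `B.card`
letters drops from one to zero and the higher ones are zero on both sides. -/
theorem starSchemes_weight {n : ℕ} (A : List α) (B : Finset α) (hB : B.card ≤ n) :
    ∀ s ∈ starSchemes A B.card, LexLE (seqWeight n s) ((Bubble.star B).weight n) := by
  intro s hs
  have hv := starSchemes_valid A _ s hs
  rcases starSchemes_size A _ s hs with h | ⟨p, rfl, hp⟩
  · rcases Nat.eq_zero_or_pos B.card with h0 | h0
    · left
      funext j
      rw [seqWeight_apply_eq_zero hv j fun p hp => by have := h p hp; omega]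
      simp [Bubble.weight_star, h0]
    · right
      -- Index `j` stands for `j + 1` letters; the empty star, which has no component, was treated
      -- separately.
      refine ⟨⟨B.card - 1, by omega⟩, ?_, fun j hj => ?_⟩
      · rw [seqWeight_apply_eq_zero hv _ fun p hp => by have := h p hp; simp; omega]
        rw [Bubble.weight_star, if_pos (Nat.sub_add_cancel h0)]
        exact one_pos
      · have hj : B.card - 1 < j := hj
        rw [seqWeight_apply_eq_zero hv _ fun p hp => by have := h p hp; omega]
        rw [Bubble.weight_star, if_neg (by omega)]
  · left
    funext j
    have := weight_bubble_of_valid (hv (Sum.inr p) (by simp)) j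
    simp [seqWeight, weight, this, hp, Bubble.weight_star]

/-- The list describes the bubble. -/
def RawBubble.Describes : RawBubble α → Bubble α → Prop
  | .inl c, .star A => ∀ t, t ∈ c ↔ t ∈ A
  | .inr p, .gathering a b _ _ _ => p.1 = a ∧ p.2 = b
  | _, _ => False

/-- The lists describe the path-scheme. -/
def RawScheme.Describes (c : RawScheme α) (ρ : PathScheme α) : Prop :=
  c.1 = ρ.head ∧
    List.Forall₂ (fun p q => RawBubble.Describes p.1 q.1 ∧ p.2 = q.2) c.2 ρ.tail

theorem expandBubble_spec {n : ℕ} {c : RawBubble α} {X : Bubble α} (h : c.Describes X)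
    (hn : X.size ≤ n) :
    (∀ w, w ∈ X.lang ↔ ∃ s ∈ expandBubble c, w ∈ seqLang s) ∧
      ∀ s ∈ expandBubble c, (∀ x ∈ s, x.Valid) ∧ LexLE (seqWeight n s) (X.weight n) := by
  match c, X, h with
  | .inl c, .star B, h =>
    -- A code may repeat letters; the recursion depth has to be the true size of the star for the
    -- weight bound.
    have hc : c.dedup.length = B.card := by
      rw [← List.card_toFinset]
      congr 1
      ext t
      simp [h t]
    simp only [expandBubble, hc]
    refine ⟨fun w => ⟨fun hw => ?_, ?_⟩, fun s hs =>
      ⟨starSchemes_valid _ _ s hs, starSchemes_weight _ B hn s hs⟩⟩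
    · have hw : ∀ t ∈ w, t ∈ B := hw
      refine starSchemes_complete _ _ w (fun t ht => by simpa [h t] using hw t ht) ?_
      exact Finset.card_le_card fun t ht => hw t (by simpa using ht)
    · rintro ⟨s, hs, hw⟩ t ht
      exact (h t).1 (List.mem_dedup.1 (starSchemes_sound _ _ s hs w hw t ht))
  | .inr (a, b), .gathering _ _ ha hb hab, ⟨rfl, rfl⟩ =>
    simp only [expandBubble, List.mem_singleton]
    refine ⟨fun w => ?_, ?_⟩
    · simp [seqLang, lang, bubble_eq ha hb hab]
    · rintro s rfl
      refine ⟨fun x hx => ?_, ?_⟩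
      · obtain rfl := List.mem_singleton.1 hx
        exact ⟨ha, hb, hab⟩
      · simp [seqWeight, weight, bubble_eq ha hb hab, LexLE.refl]

theorem expandTail_spec {n : ℕ} {c : List (RawBubble α × List α)} {τ : List (Bubble α × List α)}
    (h : List.Forall₂ (fun p q => RawBubble.Describes p.1 q.1 ∧ p.2 = q.2) c τ)
    (hn : ∀ q ∈ τ, q.1.size ≤ n) :
    (∀ w, w ∈ (τ.map fun p => p.1.lang * ({p.2} : Language α)).prod ↔
        ∃ s ∈ expandTail c, w ∈ seqLang s) ∧
      ∀ s ∈ expandTail c, (∀ x ∈ s, x.Valid) ∧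
        LexLE (seqWeight n s) (τ.map fun p => p.1.weight n).sum := by
  induction h with
  | nil =>
    simp only [expandTail, List.map_nil, List.foldr_nil, List.mem_singleton, exists_eq_left]
    refine ⟨fun w => Iff.rfl, ?_⟩
    rintro s rfl
    exact ⟨by simp, LexLE.refl _⟩
  | @cons p q c τ hpq h ih =>
    rw [List.forall_mem_cons] at hn
    obtain ⟨ih₁, ih₂⟩ := ih hn.2
    obtain ⟨hb₁, hb₂⟩ := expandBubble_spec hpq.1 hn.1
    have hmem : ∀ s, s ∈ expandTail (p :: c) ↔ ∃ s₁ ∈ expandBubble p.1, ∃ s₂ ∈ expandTail c,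
        s₁ ++ (p.2.map Sum.inl ++ s₂) = s := by
      intro s
      simp [expandTail]
    simp only [hmem, List.map_cons, List.prod_cons, List.sum_cons]
    constructor
    · intro w
      constructor
      · rw [mul_assoc, Language.mem_mul]
        rintro ⟨w₁, hw₁, w', hw', rfl⟩
        obtain ⟨u, hu, w₂, hw₂, rfl⟩ := Language.mem_mul.1 hw'
        obtain ⟨s₁, hs₁, hw₁⟩ := (hb₁ w₁).1 hw₁
        obtain ⟨s₂, hs₂, hw₂⟩ := (ih₁ w₂).1 hw₂
        refine ⟨_, ⟨s₁, hs₁, s₂, hs₂, rfl⟩, ?_⟩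
        rw [seqLang_append, seqLang_append, seqLang_map_inl, hpq.2]
        exact Language.append_mem_mul hw₁ (Language.append_mem_mul hu hw₂)
      · rintro ⟨_, ⟨s₁, hs₁, s₂, hs₂, rfl⟩, hw⟩
        rw [seqLang_append, seqLang_append, seqLang_map_inl, hpq.2, Language.mem_mul] at hw
        obtain ⟨w₁, hw₁, w', hw', rfl⟩ := hw
        obtain ⟨u, hu, w₂, hw₂, rfl⟩ := Language.mem_mul.1 hw'
        rw [mul_assoc]
        exact Language.append_mem_mul ((hb₁ w₁).2 ⟨s₁, hs₁, hw₁⟩)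
          (Language.append_mem_mul hu ((ih₁ w₂).2 ⟨s₂, hs₂, hw₂⟩))
    · rintro _ ⟨s₁, hs₁, s₂, hs₂, rfl⟩
      refine ⟨fun x hx => ?_, ?_⟩
      · simp only [List.mem_append, List.mem_map] at hx
        rcases hx with hx | ⟨t, -, rfl⟩ | hx
        · exact (hb₂ s₁ hs₁).1 x hx
        · trivial
        · exact (ih₂ s₂ hs₂).1 x hx
      · rw [seqWeight_append, seqWeight_append, seqWeight_map_inl, zero_add]
        exact (hb₂ s₁ hs₁).2.add (ih₂ s₂ hs₂).2

theorem Bubble.size_le_card {α : Type} [Fintype α] (X : Bubble α) : X.size ≤ Fintype.card α := by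
  cases X with
  | star A => exact Finset.card_le_univ A
  | gathering a b ha hb hab => exact ha.length_le_card

/-- The decomposition covers the language of the path-scheme by pre-perfect path-schemes that are
not heavier. -/
theorem expand_spec [Fintype α] {c : RawScheme α} {ρ : PathScheme α} (h : c.Describes ρ) :
    (∀ w, w ∈ ρ.lang ↔ ∃ s ∈ expand c, w ∈ seqLang s) ∧
      ∀ s ∈ expand c, (∀ x ∈ s, x.Valid) ∧ LexLE (toScheme s).weight ρ.weight := by
  obtain ⟨h₁, h₂⟩ := expandTail_spec (n := Fintype.card α) h.2 fun q _ => q.1.size_le_card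
  simp only [expand, List.mem_map]
  constructor
  · intro w
    rw [PathScheme.lang, Language.mem_mul]
    constructor
    · rintro ⟨u, hu, w, hw, rfl⟩
      obtain ⟨s, hs, hw⟩ := (h₁ w).1 hw
      refine ⟨_, ⟨s, hs, rfl⟩, ?_⟩
      rw [seqLang_append, seqLang_map_inl, h.1]
      exact Language.append_mem_mul hu hw
    · rintro ⟨_, ⟨s, hs, rfl⟩, hw⟩
      rw [seqLang_append, seqLang_map_inl, h.1, Language.mem_mul] at hw
      obtain ⟨u, hu, w, hw, rfl⟩ := hw
      exact ⟨u, hu, w, (h₁ w).2 ⟨s, hs, hw⟩, rfl⟩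
  · rintro _ ⟨s, hs, rfl⟩
    refine ⟨fun x hx => ?_, ?_⟩
    · rcases List.mem_append.1 hx with hx | hx
      · obtain ⟨t, -, rfl⟩ := List.mem_map.1 hx
        trivial
      · exact (h₂ s hs).1 x hx
    · rw [weight_toScheme, seqWeight_append, seqWeight_map_inl, zero_add]
      exact (h₂ s hs).2

end Expand

/-! ### Deciding whether a sequence of letters and gatherings has a run -/

namespace Ineq

/-- The multiple of a unit vector. -/
def unit (d i : ℕ) (q : ℤ) : List ℤ :=
  (List.range d).map fun j => if j = i then q else 0

/-- Counter `i` is nonnegative, and positive if `f i` is set. -/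
def orthant (d : ℕ) (f : ℕ → Bool) : List Ineq :=
  (List.range d).map fun i => (unit d i 1, 0, f i)

/-- The configuration equals the described one. -/
def target (d : ℕ) (c : ConfCode) : List Ineq :=
  (List.range d).flatMap fun i =>
    [(unit d i (c.getD i (0, 1)).2, -((c.getD i (0, 1)).1 : ℤ), false),
      (unit d i (-((c.getD i (0, 1)).2 : ℤ)), (c.getD i (0, 1)).1, false)]

/-- The opening of a gathering requires counter `i` to be positive. -/
def opens (a : WordCode) (i : ℕ) : Bool :=
  decide (lastNonzero (a.map fun t => t.getD i 0).reverse < 0)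

/-- The closing of a gathering makes counter `i` positive. -/
def closes (b : WordCode) (i : ℕ) : Bool :=
  decide (0 < lastNonzero (b.map fun t => t.getD i 0))

/-- The configurations from which a letter or gathering leads to a solution of `L`. -/
def back (d : ℕ) : Atom (List ℤ) → List Ineq → List Ineq
  | .inl t, L => preimage d fraction t (orthant d (fun _ => false) ++ L)
  | .inr p, L => orthant d (opens p.1) ++
      p.1.foldr (preimage d positive) (orthant d (closes p.2) ++ L)

/-- A common multiple of the denominators. -/
def denom (c : ConfCode) : ℕ := (c.map Prod.snd).prod

/-- The value of the left-hand side, multiplied by the common denominator. -/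
def scaledEval (d : ℕ) (c : ConfCode) (K : Ineq) : ℤ :=
  ((List.range d).map fun i =>
    K.1.getD i 0 * (((c.getD i (0, 1)).1 * (denom c / (c.getD i (0, 1)).2) : ℕ) : ℤ)).sum +
    K.2.1 * (denom c : ℤ)

/-- The described configuration satisfies the inequality. -/
def Satisfies (d : ℕ) (c : ConfCode) (K : Ineq) : Prop :=
  0 ≤ scaledEval d c K ∧ (K.2.2 = true → 0 < scaledEval d c K)

instance (d : ℕ) (c : ConfCode) (K : Ineq) : Decidable (Satisfies d c K) := by
  unfold Satisfies
  infer_instance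

/-- There is a run between the described configurations along `s`. -/
def Feasible (d : ℕ) (x y : ConfCode) (s : List (Atom (List ℤ))) : Prop :=
  ∀ K ∈ s.foldr (back d) (target d y), Satisfies d x K

instance (d : ℕ) (x y : ConfCode) (s : List (Atom (List ℤ))) : Decidable (Feasible d x y s) := by
  unfold Feasible
  infer_instance

/-! ### Correctness of the feasibility test -/

variable {d : ℕ}

theorem eval_unit (i : Fin d) (q k : ℤ) (s : Bool) (x : Fin d → ℚ) :
    eval (unit d i q, k, s) x = q * x i + k := by
  have h : ∀ j : Fin d, ((unit d i q).getD j 0 : ℚ) * x j = if j = i then q * x i else 0 := by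
    intro j
    simp only [unit]
    by_cases hj : j = i
    · subst hj
      simp
    · have : (j : ℕ) ≠ i := fun h => hj (Fin.ext h)
      simp [hj, this]
  simp only [eval, h, Finset.sum_ite_eq', Finset.mem_univ, if_true]

theorem forall_orthant_iff (f : ℕ → Bool) (x : Fin d → ℚ) :
    (∀ K ∈ orthant d f, K.Holds x) ↔ ∀ i : Fin d, Pos (f i) (x i) := by
  simp only [orthant, List.forall_mem_map, List.mem_range, Holds]
  constructor
  · intro h i
    simpa [eval_unit] using h i i.2
  · intro h i hi
    have := eval_unit ⟨i, hi⟩ 1 0 (f i) x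
    simp only [Int.cast_one, one_mul, Int.cast_zero, add_zero] at this
    rw [this]
    exact h ⟨i, hi⟩

theorem getD_of_isConfCode {c : ConfCode} {x : CVAS.Conf d} (h : IsConfCode c x) (i : Fin d) :
    (c.getD i (0, 1)).2 ≠ 0 ∧
      (x i : ℚ) = ((c.getD i (0, 1)).1 : ℚ) / ((c.getD i (0, 1)).2 : ℚ) := by
  have hlen : c.length = d := by simpa using h.length_eq
  have hi : (i : ℕ) < c.length := by rw [hlen]; exact i.2
  have := List.Forall₂.get h hi (by simp)
  rw [List.getD_eq_getElem _ _ hi]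
  simp only [List.get_eq_getElem, List.getElem_ofFn] at this
  refine ⟨this.1, ?_⟩
  rw [this.2]
  simp

/-- Equality with a fraction is two opposite inequalities, with the denominator cleared so that the
coefficients are integers. -/
theorem forall_target_iff {c : ConfCode} {y : CVAS.Conf d} (h : IsConfCode c y) (x : Fin d → ℚ) :
    (∀ K ∈ target d c, K.Holds x) ↔ ∀ i, x i = y i := by
  have key : ∀ i : Fin d, (Pos false (eval (unit d i (c.getD i (0, 1)).2,
      -((c.getD i (0, 1)).1 : ℤ), false) x) ∧ Pos false (eval (unit d i
      (-((c.getD i (0, 1)).2 : ℤ)), ((c.getD i (0, 1)).1 : ℤ), false) x)) ↔ x i = y i := by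
    intro i
    obtain ⟨h0, hy⟩ := getD_of_isConfCode h i
    have h0' : (0 : ℚ) < (c.getD i (0, 1)).2 := by exact_mod_cast Nat.pos_of_ne_zero h0
    rw [hy, eval_unit, eval_unit, eq_div_iff h0'.ne']
    simp only [Pos, Bool.false_eq_true, false_imp_iff, and_true]
    push_cast
    constructor
    · rintro ⟨h1, h2⟩
      linarith
    · intro h
      constructor <;> linarith
  simp only [target, List.mem_flatMap, List.mem_range, Holds]
  constructor
  · intro hK i
    exact (key i).1 ⟨hK _ ⟨i, i.2, by simp⟩, hK _ ⟨i, i.2, by simp⟩⟩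
  · rintro hx K ⟨i, hi, hK⟩
    have := (key ⟨i, hi⟩).2 (hx _)
    rcases List.mem_cons.1 hK with rfl | hK
    · exact this.1
    · obtain rfl := List.mem_singleton.1 hK
      exact this.2

/-- Multiplication by the positive common denominator keeps signs, so the test needs integer
arithmetic only. -/
theorem satisfies_iff {c : ConfCode} {x : CVAS.Conf d} (h : IsConfCode c x) (K : Ineq) :
    Satisfies d c K ↔ K.Holds fun i => (x i : ℚ) := by
  have hden : 0 < denom c := by
    apply List.prod_pos
    simp only [List.mem_map]
    rintro _ ⟨p, hp, rfl⟩
    obtain ⟨i, hi, rfl⟩ := List.mem_iff_getElem.1 hp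
    have hlen : c.length = d := by simpa using h.length_eq
    have := (getD_of_isConfCode h ⟨i, hlen ▸ hi⟩).1
    rw [List.getD_eq_getElem _ _ hi] at this
    exact Nat.pos_of_ne_zero this
  have hden' : (0 : ℚ) < denom c := by exact_mod_cast hden
  have key : (scaledEval d c K : ℚ) = denom c * K.eval fun i => (x i : ℚ) := by
    have hsum : ((List.range d).map fun i => K.1.getD i 0 *
        (((c.getD i (0, 1)).1 * (denom c / (c.getD i (0, 1)).2) : ℕ) : ℤ)).sum =
        ∑ i : Fin d, K.1.getD i 0 *
          (((c.getD i (0, 1)).1 * (denom c / (c.getD i (0, 1)).2) : ℕ) : ℤ) := by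
      rw [← Finset.sum_range fun i => K.1.getD i 0 *
        (((c.getD i (0, 1)).1 * (denom c / (c.getD i (0, 1)).2) : ℕ) : ℤ)]
      rfl
    rw [scaledEval, hsum, eval]
    rw [Int.cast_add, Int.cast_sum, Int.cast_mul, Int.cast_natCast, mul_add, Finset.mul_sum,
      mul_comm (K.2.1 : ℚ)]
    congr 1
    refine Finset.sum_congr rfl fun i _ => ?_
    obtain ⟨h0, hx⟩ := getD_of_isConfCode h i
    -- This makes the natural number division in `scaledEval` exact.
    have hdvd : (c.getD i (0, 1)).2 ∣ denom c := by
      apply List.dvd_prod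
      have hi : (i : ℕ) < c.length := by
        have : c.length = d := by simpa using h.length_eq
        rw [this]
        exact i.2
      rw [List.getD_eq_getElem _ _ hi]
      exact List.mem_map_of_mem (List.getElem_mem hi)
    rw [Int.cast_mul, Int.cast_natCast, Nat.cast_mul, Nat.cast_div hdvd (Nat.cast_ne_zero.2 h0), hx]
    ring
  simp only [Satisfies, Holds, Pos]
  rw [← Int.cast_nonneg_iff (R := ℚ), ← Int.cast_pos (R := ℚ), key, mul_nonneg_iff_of_pos_left hden',
    mul_pos_iff_of_pos_left hden']

variable {S : Finset (Fin d → ℤ)}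

/-- The code of a letter. -/
def letterCode (t : S) : List ℤ := List.ofFn t.1

/-- Renaming of the letters. -/
def _root_.Atom.map {α β : Type} (φ : α → β) : Atom α → Atom β :=
  Sum.map φ (Prod.map (List.map φ) (List.map φ))

theorem map_getD_map_letterCode (a : List S) (i : Fin d) :
    (a.map letterCode).map (fun t => t.getD i 0) = a.map fun t => t.1 i := by
  rw [List.map_map]
  refine List.map_congr_left fun t _ => ?_
  simp [letterCode]

theorem opens_iff (a : List S) (i : Fin d) : opens (a.map letterCode) i = true ↔
    lastNonzero (a.map fun t => t.1 i).reverse < 0 := by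
  rw [opens, map_getD_map_letterCode, decide_eq_true_eq]

theorem closes_iff (b : List S) (i : Fin d) : closes (b.map letterCode) i = true ↔
    0 < lastNonzero (b.map fun t => t.1 i) := by
  rw [closes, map_getD_map_letterCode, decide_eq_true_eq]

theorem forall_preimage_letterCode_iff (B : List (ℤ × Ineq)) (t : S) (L : List Ineq)
    (x : Fin d → ℚ) :
    (∀ K ∈ preimage d B (letterCode t) L, K.Holds x) ↔
      ∃ α : ℚ, (∀ p ∈ B, Pos p.2.2.2 (p.2.eval x + α * p.1)) ∧
        ∀ K ∈ L, K.Holds fun i => x i + α * t.1 i :=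
  forall_preimage_holds_iff B t.1 L x

/-- Each step eliminates the multiplier of one letter. As the letters are distinct, the multipliers
are independent and form one function `P`. -/
theorem forall_foldr_preimage_iff {a : List S} (ha : a.Nodup) (L : List Ineq) (x : Fin d → ℚ) :
    (∀ K ∈ (a.map letterCode).foldr (preimage d positive) L, K.Holds x) ↔
      ∃ P : S → ℚ, (∀ t ∈ a, 0 < P t) ∧
        ∀ K ∈ L, K.Holds fun i => x i + (a.map fun t => P t * t.1 i).sum := by
  induction a generalizing x with
  | nil =>
    simp only [List.map_nil, List.foldr_nil, List.sum_nil, add_zero, List.not_mem_nil,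
      false_imp_iff, implies_true, true_and]
    exact ⟨fun h => ⟨0, h⟩, fun ⟨_, h⟩ => h⟩
  | cons s a ih =>
    rw [List.nodup_cons] at ha
    simp only [List.map_cons, List.foldr_cons, forall_preimage_letterCode_iff, forall_positive_iff,
      ih ha.2, List.sum_cons, List.forall_mem_cons]
    constructor
    · rintro ⟨α, hα, P, hP, hL⟩
      refine ⟨Function.update P s α, ⟨by simpa using hα, fun t ht => ?_⟩, ?_⟩
      · rw [Function.update_of_ne (by rintro rfl; exact ha.1 ht)]
        exact hP t ht
      · have : ∀ i, (a.map fun t => Function.update P s α t * (t.1 i : ℚ)) =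
            a.map fun t => P t * (t.1 i : ℚ) := fun i =>
          List.map_congr_left fun t ht => by
            rw [Function.update_of_ne (by rintro rfl; exact ha.1 ht)]
        simpa only [this, Function.update_self, ← add_assoc] using hL
    · rintro ⟨P, ⟨hs, hP⟩, hL⟩
      exact ⟨P s, hs, P, hP, by simpa only [← add_assoc] using hL⟩

/-- Backward induction: the intermediate configuration after the first atom is projected away. For a
gathering this is possible because its reachability relation is linear in both ends. -/
theorem forall_foldr_back_iff {c : ConfCode} {y : CVAS.Conf d} (hc : IsConfCode c y)
    {s : List (Atom S)} (hs : ∀ a ∈ s, a.Valid) (x : CVAS.Conf d) :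
    (∀ K ∈ (s.map (Atom.map letterCode)).foldr (back d) (target d c),
        K.Holds fun i => (x i : ℚ)) ↔ ∃ w ∈ Atom.seqLang s, CVAS.Reach x w y := by
  induction s generalizing x with
  | nil =>
    simp only [List.map_nil, List.foldr_nil, forall_target_iff hc]
    constructor
    · intro h
      exact ⟨[], rfl, funext fun i => NNRat.coe_injective (h i)⟩
    · rintro ⟨w, hw, h⟩
      obtain rfl : w = [] := hw
      obtain rfl : x = y := h
      exact fun _ => rfl
  | cons a s ih =>
    rw [List.forall_mem_cons] at hs
    have ih := ih hs.2
    rw [List.map_cons, List.foldr_cons, ← List.singleton_append (l := s), Atom.seqLang_append]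
    have hmul : (∃ w ∈ Atom.seqLang [a] * Atom.seqLang s, CVAS.Reach x w y) ↔
        ∃ z, (∃ u ∈ Atom.lang a, CVAS.Reach x u z) ∧
          ∃ v ∈ Atom.seqLang s, CVAS.Reach z v y := by
      have : Atom.seqLang [a] = Atom.lang a := by simp [Atom.seqLang]
      rw [this]
      constructor
      · rintro ⟨w, hw, hr⟩
        obtain ⟨u, hu, v, hv, rfl⟩ := Language.mem_mul.1 hw
        obtain ⟨z, hxz, hzy⟩ := (CVAS.reach_append _ _ _ _).1 hr
        exact ⟨z, ⟨u, hu, hxz⟩, v, hv, hzy⟩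
      · rintro ⟨z, ⟨u, hu, hxz⟩, v, hv, hzy⟩
        exact ⟨_, Language.append_mem_mul hu hv, (CVAS.reach_append _ _ _ _).2 ⟨z, hxz, hzy⟩⟩
    rw [hmul]
    rcases a with t | ⟨a, b⟩
    · simp only [Atom.map, Sum.map_inl, back]
      simp only [forall_preimage_letterCode_iff, forall_fraction_iff, List.forall_mem_append,
        forall_orthant_iff]
      constructor
      · rintro ⟨α, ⟨h0, h1⟩, hnn, hL⟩
        -- The orthant inequalities in `back` turn the rational endpoint into a configuration.
        refine ⟨fun i => ⟨x i + α * t.1 i, (hnn i).1⟩, ⟨[t], rfl, α, _, ⟨h0, h1, fun i => rfl⟩, rfl⟩,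
          (ih _).1 hL⟩
      · rintro ⟨z, ⟨u, hu, hr⟩, hv⟩
        obtain rfl : u = [t] := hu
        obtain ⟨α, z', ⟨h0, h1, hz⟩, hz'⟩ := hr
        obtain rfl : z' = z := hz'
        have := (ih z').2 hv
        simp only [hz] at this
        exact ⟨α, ⟨h0, h1⟩, fun i => ⟨by rw [← hz]; exact (z' i).2, by simp⟩, this⟩
    · obtain ⟨ha, hb, hab⟩ := hs.1
      have ha : a.Nodup := ha
      have hlang : Atom.lang (Sum.inr (a, b)) = (Bubble.gathering a b ha hb hab).lang := by
        rw [Atom.lang, Atom.bubble_eq]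
      simp only [hlang, CVAS.exists_reach_gathering_iff]
      simp only [Atom.map, Sum.map_inr, back, Prod.map, List.forall_mem_append, forall_orthant_iff,
        forall_foldr_preimage_iff ha]
      simp only [Pos, opens_iff, closes_iff]
      constructor
      · rintro ⟨hx, P, hP, hz, hL⟩
        refine ⟨fun i => ⟨x i + (a.map fun t => P t * t.1 i).sum, (hz i).1⟩,
          ⟨fun i hi => ?_, fun i hi => ?_, P, hP, fun i => rfl⟩, (ih _).1 hL⟩
        · exact_mod_cast (hx i).2 hi
        · exact (hz i).2 hi
      · rintro ⟨z, ⟨hx, hz, P, hP, hPz⟩, hv⟩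
        have := (ih z).2 hv
        simp only [hPz] at this
        refine ⟨fun i => ⟨(x i).2, fun hi => ?_⟩, P, hP, fun i => ?_, this⟩
        · exact_mod_cast hx i hi
        · rw [← hPz]
          exact ⟨(z i).2, fun hi => by exact_mod_cast hz i hi⟩

theorem feasible_iff {cx cy : ConfCode} {x y : CVAS.Conf d} (hx : IsConfCode cx x)
    (hy : IsConfCode cy y) {s : List (Atom S)} (hs : ∀ a ∈ s, a.Valid) :
    Feasible d cx cy (s.map (Atom.map letterCode)) ↔
      ∃ w ∈ Atom.seqLang s, CVAS.Reach x w y := by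
  rw [← forall_foldr_back_iff hy hs x, Feasible]
  simp only [satisfies_iff hx]

end Ineq

/-! ### Primitive recursive functions on integers and lists -/

namespace Primrec

variable {α β : Type} [Primcodable α] [Primcodable β]

/-- Integers are coded by parity: even codes for nonnegative numbers, odd ones for negative numbers.
-/
theorem encode_int_natCast (n : ℕ) : Encodable.encode (n : ℤ) = 2 * n := rfl

theorem encode_int_negSucc (n : ℕ) : Encodable.encode (Int.negSucc n) = 2 * n + 1 := rfl

theorem int_toNat : Primrec Int.toNat := by
  refine (Primrec.ite (c := fun n : ℤ => Encodable.encode n % 2 = 0)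
    (Primrec.eq.comp (nat_mod.comp Primrec.encode (const 2)) (const 0))
    (nat_div.comp Primrec.encode (const 2)) (const 0)).of_eq fun n => ?_
  cases n with
  | ofNat n =>
    rw [Int.ofNat_eq_natCast, encode_int_natCast, if_pos (by omega)]
    simp
  | negSucc n =>
    rw [encode_int_negSucc, if_neg (by omega)]
    simp

theorem int_neg_toNat : Primrec fun n : ℤ => (-n).toNat := by
  refine (Primrec.ite (c := fun n : ℤ => Encodable.encode n % 2 = 0)
    (Primrec.eq.comp (nat_mod.comp Primrec.encode (const 2)) (const 0))
    (const 0) (succ.comp (nat_div.comp Primrec.encode (const 2)))).of_eq fun n => ?_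
  cases n with
  | ofNat n =>
    rw [Int.ofNat_eq_natCast, encode_int_natCast, if_pos (by omega)]
    simp
  | negSucc n =>
    rw [encode_int_negSucc, if_neg (by omega), Int.neg_negSucc]
    simp
    omega

/-- Integer arithmetic reduces to natural numbers by writing each integer as the difference of its
positive and negative parts. -/
theorem int_subNat : Primrec₂ fun m n : ℕ => (m : ℤ) - n := by
  have h : Primrec₂ fun m n : ℕ => if n ≤ m then 2 * (m - n) else 2 * (n - m - 1) + 1 :=
    Primrec.ite (nat_le.comp snd fst) (nat_mul.comp (const 2) (nat_sub.comp fst snd))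
      (succ.comp (nat_mul.comp (const 2) (nat_sub.comp (nat_sub.comp snd fst) (const 1))))
  refine Primrec₂.encode_iff.1 (h.of_eq fun m n => ?_)
  split_ifs with hmn
  · rw [← encode_int_natCast, Nat.cast_sub hmn]
  · rw [← encode_int_negSucc]
    congr 1
    omega

theorem int_add {f g : α → ℤ} (hf : Primrec f) (hg : Primrec g) : Primrec fun a => f a + g a :=
  (int_subNat.comp (nat_add.comp (int_toNat.comp hf) (int_toNat.comp hg))
    (nat_add.comp (int_neg_toNat.comp hf) (int_neg_toNat.comp hg))).of_eq fun a => by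
      push_cast
      omega

theorem int_neg {f : α → ℤ} (hf : Primrec f) : Primrec fun a => -f a :=
  (int_subNat.comp (int_neg_toNat.comp hf) (int_toNat.comp hf)).of_eq fun a => by omega

theorem int_natCast {f : α → ℕ} (hf : Primrec f) : Primrec fun a => (f a : ℤ) :=
  (int_subNat.comp hf (const 0)).of_eq fun a => by simp

theorem int_mul {f g : α → ℤ} (hf : Primrec f) (hg : Primrec g) : Primrec fun a => f a * g a :=
  (int_subNat.comp
    (nat_add.comp (nat_mul.comp (int_toNat.comp hf) (int_toNat.comp hg))
      (nat_mul.comp (int_neg_toNat.comp hf) (int_neg_toNat.comp hg)))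
    (nat_add.comp (nat_mul.comp (int_toNat.comp hf) (int_neg_toNat.comp hg))
      (nat_mul.comp (int_neg_toNat.comp hf) (int_toNat.comp hg)))).of_eq fun a => by
      have hf := Int.toNat_sub_toNat_neg (f a)
      have hg := Int.toNat_sub_toNat_neg (g a)
      conv_rhs => rw [← hf, ← hg]
      push_cast
      ring

theorem int_pos {f : α → ℤ} (hf : Primrec f) : PrimrecPred fun a => 0 < f a :=
  (nat_lt.comp (const 0) (int_toNat.comp hf)).of_eq fun a => by omega

theorem int_neg_iff {f : α → ℤ} (hf : Primrec f) : PrimrecPred fun a => f a < 0 :=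
  (int_pos (int_neg hf)).of_eq fun a => by omega

theorem int_nonneg {f : α → ℤ} (hf : Primrec f) : PrimrecPred fun a => 0 ≤ f a :=
  (int_neg_iff hf).not.of_eq fun a => by omega

theorem list_sum_int {f : α → List ℤ} (hf : Primrec f) : Primrec fun a => (f a).sum :=
  (list_foldr hf (const 0) (int_add (fst.comp snd) (snd.comp snd)).to₂).of_eq fun _ => rfl

theorem list_prod_nat {f : α → List ℕ} (hf : Primrec f) : Primrec fun a => (f a).prod :=
  (list_foldr hf (const 1) (nat_mul.comp (fst.comp snd) (snd.comp snd)).to₂).of_eq fun _ => rfl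

theorem list_filter {f : α → List β} {p : α → β → Prop} [∀ a b, Decidable (p a b)]
    (hf : Primrec f) (hp : PrimrecPred fun q : α × β => p q.1 q.2) :
    Primrec fun a => (f a).filter (p a ·) :=
  (list_flatMap hf (Primrec.ite hp (list_cons.comp snd (const [])) (const [])).to₂).of_eq fun a => by
    induction f a with
    | nil => rfl
    | cons b l ih =>
      rw [List.flatMap_cons, ih, List.filter_cons]
      by_cases h : p a b <;> simp [h]

theorem list_forall {f : α → List β} {p : α → β → Prop} (hf : Primrec f)
    (hp : PrimrecPred fun q : α × β => p q.1 q.2) : PrimrecPred fun a => ∀ b ∈ f a, p a b := by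
  classical
  refine (Primrec.eq.comp (list_filter (p := fun a b => ¬ p a b) hf hp.not) (const [])).of_eq
    fun a => ?_
  simp

theorem list_mem {f : α → List β} {g : α → β} (hf : Primrec f) (hg : Primrec g) :
    PrimrecPred fun a => g a ∈ f a :=
  (list_forall (p := fun a b => ¬ b = g a) hf
    (Primrec.eq.comp snd (hg.comp fst)).not).not.of_eq fun a => by simp

theorem list_dedup [DecidableEq β] {f : α → List β} (hf : Primrec f) :
    Primrec fun a => (f a).dedup :=
  (list_foldr (h := fun _ (p : β × List β) => if p.1 ∈ p.2 then p.2 else p.1 :: p.2)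
    hf (const []) (Primrec.ite (list_mem (snd.comp snd) (fst.comp snd)) (snd.comp snd)
      (list_cons.comp (fst.comp snd) (snd.comp snd))).to₂).of_eq fun a => by
    induction f a with
    | nil => rfl
    | cons b l ih => rw [List.foldr_cons, ih, List.dedup_cons']

end Primrec

open Primrec

/-! ### Computability of the decomposition -/

section Expand

variable {α : Type} [Primcodable α]

theorem primrec_map_inl : Primrec fun u : List α => (u.map Sum.inl : List (Atom α)) :=
  list_map Primrec.id (sumInl.comp snd)

/-- The path-scheme of a sequence of letters and gatherings. -/
def toRaw {α : Type} (s : List (Atom α)) : RawScheme α :=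
  s.foldr (fun x c => Sum.casesOn x (fun t => (t :: c.1, c.2)) fun p => ([], (Sum.inr p, c.1) :: c.2))
    ([], [])

theorem primrec_toRaw : Primrec (toRaw : List (Atom α) → RawScheme α) := by
  refine list_foldr (h := fun _ (q : Atom α × RawScheme α) => Sum.casesOn q.1
    (fun t => (t :: q.2.1, q.2.2)) fun p => ([], (Sum.inr p, q.2.1) :: q.2.2))
    Primrec.id (const _) ?_
  refine Primrec.sumCasesOn (fst.comp snd) ?_ ?_
  · exact Primrec.pair (list_cons.comp snd (fst.comp (snd.comp (snd.comp fst))))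
      (snd.comp (snd.comp (snd.comp fst)))
  · exact Primrec.pair (const []) (list_cons.comp
      (Primrec.pair (sumInr.comp snd) (fst.comp (snd.comp (snd.comp fst))))
      (snd.comp (snd.comp (snd.comp fst))))

variable [DecidableEq α]

theorem primrec_nodupLists : Primrec₂ (nodupLists : List α → ℕ → List (List α)) := by
  refine (Primrec.nat_rec (f := fun _ : List α => ([[]] : List (List α)))
    (g := fun A p => p.2.flatMap fun l => A.flatMap fun c => if c ∈ l then [] else [c :: l])
    (Primrec.const _) ?_).of_eq fun A k => ?_
  · refine list_flatMap (snd.comp snd) (list_flatMap (fst.comp fst) ?_)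
    exact Primrec.ite (list_mem (snd.comp fst) snd) (const [])
      (list_cons.comp (list_cons.comp snd (snd.comp fst)) (const []))
  · induction k with
    | zero => rfl
    | succ k ih => rw [nodupLists, ← ih]

theorem primrec_gatherings : Primrec₂ (gatherings : List α → ℕ → List (List (Atom α))) := by
  refine list_flatMap primrec_nodupLists
    (list_flatMap (primrec_nodupLists.comp (fst.comp fst) (snd.comp fst)) ?_)
  refine Primrec.ite (list_forall (p := fun (q : ((List α × ℕ) × List α) × List α) c => c ∈ q.2)
    (snd.comp fst) (list_mem (snd.comp fst) snd)) ?_ (const [])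
  exact list_cons.comp (list_cons.comp (sumInr.comp (Primrec.pair (snd.comp fst) snd)) (const []))
    (const [])

theorem primrec_starSchemes : Primrec₂ (starSchemes : List α → ℕ → List (List (Atom α))) := by
  refine (Primrec.nat_rec (f := fun _ : List α => ([[]] : List (List (Atom α))))
    (g := fun A p => p.2 ++ (gatherings A (p.1 + 1) ++
      p.2.flatMap fun s => p.2.flatMap fun s' => A.map fun c => s ++ Sum.inl c :: s'))
    (Primrec.const _) ?_).of_eq fun A k => ?_
  · refine list_append.comp (snd.comp snd) (list_append.comp
      (primrec_gatherings.comp fst (succ.comp (fst.comp snd))) ?_)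
    refine list_flatMap (snd.comp snd) (list_flatMap (snd.comp (snd.comp fst))
      (list_map (fst.comp (fst.comp fst)) ?_))
    exact list_append.comp (snd.comp (fst.comp fst))
      (list_cons.comp (sumInl.comp snd) (snd.comp fst))
  · induction k with
    | zero => rfl
    | succ k ih => rw [starSchemes, ← ih]

theorem primrec_expandBubble :
    Primrec (expandBubble : RawBubble α → List (List (Atom α))) := by
  refine (Primrec.sumCasesOn (f := id)
    (g := fun (_ : RawBubble α) (A : List α) => starSchemes A.dedup A.dedup.length)
    (h := fun (_ : RawBubble α) (p : List α × List α) => [[(Sum.inr p : Atom α)]]) Primrec.id ?_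
    ?_).of_eq fun b => ?_
  · exact primrec_starSchemes.comp (list_dedup snd) (list_length.comp (list_dedup snd))
  · exact list_cons.comp (list_cons.comp (sumInr.comp snd) (const [])) (const [])
  · cases b <;> rfl

theorem primrec_expand : Primrec (expand : RawScheme α → List (List (Atom α))) := by
  have h : Primrec (expandTail : List (RawBubble α × List α) → List (List (Atom α))) := by
    refine list_foldr (h := fun _ (q : (RawBubble α × List α) × List (List (Atom α))) =>
      (expandBubble q.1.1).flatMap fun s => q.2.map fun r => s ++ (q.1.2.map Sum.inl ++ r))
      Primrec.id (const _) ?_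
    refine list_flatMap (primrec_expandBubble.comp (fst.comp (fst.comp snd)))
      (list_map (snd.comp (snd.comp fst)) ?_)
    exact list_append.comp (snd.comp fst) (list_append.comp
      (primrec_map_inl.comp (snd.comp (fst.comp (snd.comp (fst.comp fst))))) snd)
  exact list_map (h.comp snd) (list_append.comp (primrec_map_inl.comp (fst.comp fst)) snd)

end Expand

/-! ### Primitive recursiveness of the feasibility test -/

namespace Ineq

variable {α : Type} [Primcodable α]

theorem primrec_getD {f : α → List ℤ} {g : α → ℕ} (hf : Primrec f) (hg : Primrec g) :
    Primrec fun a => (f a).getD (g a) 0 :=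
  (list_getD 0).comp hf hg

theorem primrec_dot {d : α → ℕ} {k t : α → List ℤ} (hd : Primrec d) (hk : Primrec k)
    (ht : Primrec t) : Primrec fun a => dot (d a) (k a) (t a) :=
  list_sum_int (list_map (list_range.comp hd)
    (int_mul (primrec_getD (hk.comp fst) snd) (primrec_getD (ht.comp fst) snd)))

theorem primrec_combine {d : α → ℕ} {p q : α → ℤ × Ineq} (hd : Primrec d) (hp : Primrec p)
    (hq : Primrec q) : Primrec fun a => combine (d a) (p a) (q a) := by
  have hp1 := fst.comp hp
  have hq1 := int_neg (fst.comp hq)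
  have hp2 := snd.comp hp
  have hq2 := snd.comp hq
  refine Primrec.pair (list_map (list_range.comp hd) ?_) (Primrec.pair
    (int_add (int_mul hq1 (fst.comp (snd.comp hp2))) (int_mul hp1 (fst.comp (snd.comp hq2))))
    (Primrec.or.comp (snd.comp (snd.comp hp2)) (snd.comp (snd.comp hq2))))
  exact int_add (int_mul (hq1.comp fst) (primrec_getD ((fst.comp hp2).comp fst) snd))
    (int_mul (hp1.comp fst) (primrec_getD ((fst.comp hq2).comp fst) snd))

theorem primrec_eliminate {d : α → ℕ} {L : α → List (ℤ × Ineq)} (hd : Primrec d)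
    (hL : Primrec L) : Primrec fun a => eliminate (d a) (L a) := by
  refine list_flatMap hL (list_flatMap (hL.comp fst) ?_)
  refine Primrec.ite ((int_pos (fst.comp (snd.comp fst))).and (int_neg_iff (fst.comp snd))) ?_
    (Primrec.ite (Primrec.eq.comp (fst.comp (snd.comp fst)) (const 0)) ?_ (const []))
  · exact list_cons.comp (primrec_combine (hd.comp (fst.comp fst)) (snd.comp fst) snd) (const [])
  · exact list_cons.comp (snd.comp (snd.comp fst)) (const [])

theorem primrec_preimage {d : α → ℕ} (B : List (ℤ × Ineq)) {t : α → List ℤ}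
    {L : α → List Ineq} (hd : Primrec d) (ht : Primrec t) (hL : Primrec L) :
    Primrec fun a => preimage (d a) B (t a) (L a) :=
  primrec_eliminate hd (list_append.comp (const B) (list_map hL
    (Primrec.pair (primrec_dot (hd.comp fst) (fst.comp snd) (ht.comp fst)) snd)))

theorem primrec_unit {d i : α → ℕ} {q : α → ℤ} (hd : Primrec d) (hi : Primrec i)
    (hq : Primrec q) : Primrec fun a => unit (d a) (i a) (q a) :=
  list_map (list_range.comp hd)
    (Primrec.ite (Primrec.eq.comp snd (hi.comp fst)) (hq.comp fst) (const 0))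

theorem primrec_orthant {d : α → ℕ} {f : α → ℕ → Bool} (hd : Primrec d) (hf : Primrec₂ f) :
    Primrec fun a => orthant (d a) (f a) :=
  list_map (list_range.comp hd)
    (Primrec.pair (primrec_unit (hd.comp fst) snd (const 1)) (Primrec.pair (const 0) hf))

theorem primrec_target {d : α → ℕ} {c : α → ConfCode} (hd : Primrec d) (hc : Primrec c) :
    Primrec fun a => target (d a) (c a) := by
  refine list_flatMap (list_range.comp hd) ?_
  have h : Primrec fun p : α × ℕ => (c p.1).getD p.2 (0, 1) :=
    (list_getD (0, 1)).comp (hc.comp fst) snd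
  have h1 := int_natCast (fst.comp h)
  have h2 := int_natCast (snd.comp h)
  exact list_cons.comp (Primrec.pair (primrec_unit (hd.comp fst) snd h2)
    (Primrec.pair (int_neg h1) (const false))) (list_cons.comp
      (Primrec.pair (primrec_unit (hd.comp fst) snd (int_neg h2)) (Primrec.pair h1 (const false)))
      (const []))

theorem primrec_lastNonzero : Primrec lastNonzero := by
  refine list_foldr (h := fun _ (q : ℤ × ℤ) => if q.2 = 0 then q.1 else q.2) Primrec.id (const 0) ?_
  exact Primrec.ite (Primrec.eq.comp (snd.comp snd) (const 0)) (fst.comp snd) (snd.comp snd)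

theorem primrec_opens : Primrec₂ opens := by
  refine (int_neg_iff (primrec_lastNonzero.comp (list_reverse.comp (list_map fst ?_)))).decide
  exact primrec_getD snd (snd.comp fst)

theorem primrec_closes : Primrec₂ closes := by
  refine (int_pos (primrec_lastNonzero.comp (list_map fst ?_))).decide
  exact primrec_getD snd (snd.comp fst)

theorem primrec_back : Primrec fun q : ℕ × Atom (List ℤ) × List Ineq => back q.1 q.2.1 q.2.2 := by
  refine (Primrec.sumCasesOn (f := fun q : ℕ × Atom (List ℤ) × List Ineq => q.2.1)
    (g := fun q t => preimage q.1 fraction t (orthant q.1 (fun _ => false) ++ q.2.2))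
    (h := fun q p => orthant q.1 (opens p.1) ++
      p.1.foldr (preimage q.1 positive) (orthant q.1 (closes p.2) ++ q.2.2))
    (fst.comp snd) ?_ ?_).of_eq fun q => ?_
  · exact primrec_preimage fraction (fst.comp fst) snd (list_append.comp
      (primrec_orthant (fst.comp fst) (const false)) (snd.comp (snd.comp fst)))
  · refine list_append.comp (primrec_orthant (fst.comp fst)
      (primrec_opens.comp (fst.comp (snd.comp fst)) snd)) ?_
    refine list_foldr (h := fun (r : (ℕ × Atom (List ℤ) × List Ineq) × WordCode × WordCode)
      (s : List ℤ × List Ineq) => preimage r.1.1 positive s.1 s.2) (fst.comp snd)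
      (list_append.comp (primrec_orthant (fst.comp fst)
        (primrec_closes.comp (snd.comp (snd.comp fst)) snd)) (snd.comp (snd.comp fst))) ?_
    exact primrec_preimage positive (fst.comp (fst.comp fst)) (fst.comp snd) (snd.comp snd)
  · rcases q with ⟨d, t | p, L⟩ <;> rfl

theorem primrec_denom {c : α → ConfCode} (hc : Primrec c) : Primrec fun a => denom (c a) :=
  list_prod_nat (list_map hc (snd.comp snd))

theorem primrec_scaledEval {d : α → ℕ} {c : α → ConfCode} {K : α → Ineq} (hd : Primrec d)
    (hc : Primrec c) (hK : Primrec K) : Primrec fun a => scaledEval (d a) (c a) (K a) := by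
  refine int_add (list_sum_int (list_map (list_range.comp hd) ?_))
    (int_mul (fst.comp (snd.comp hK)) (int_natCast (primrec_denom hc)))
  have h : Primrec fun p : α × ℕ => (c p.1).getD p.2 (0, 1) :=
    (list_getD (0, 1)).comp (hc.comp fst) snd
  exact int_mul (primrec_getD ((fst.comp hK).comp fst) snd) (int_natCast (nat_mul.comp (fst.comp h)
    (nat_div.comp ((primrec_denom hc).comp fst) (snd.comp h))))

theorem primrec_satisfies {d : α → ℕ} {c : α → ConfCode} {K : α → Ineq} (hd : Primrec d)
    (hc : Primrec c) (hK : Primrec K) : PrimrecPred fun a => Satisfies (d a) (c a) (K a) := by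
  have h := primrec_scaledEval hd hc hK
  refine ((int_nonneg h).and ((Primrec.eq.comp (snd.comp (snd.comp hK)) (const true)).not.or
    (int_pos h))).of_eq fun a => ?_
  rw [Satisfies, imp_iff_not_or]

theorem primrec_feasible {d : α → ℕ} {x y : α → ConfCode} {s : α → List (Atom (List ℤ))}
    (hd : Primrec d) (hx : Primrec x) (hy : Primrec y) (hs : Primrec s) :
    PrimrecPred fun a => Feasible (d a) (x a) (y a) (s a) := by
  refine list_forall (p := fun a K => Satisfies (d a) (x a) K) ?_
    (primrec_satisfies (hd.comp fst) (hx.comp fst) snd)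
  refine list_foldr (h := fun a (q : Atom (List ℤ) × List Ineq) => back (d a) q.1 q.2) hs
    (primrec_target hd hy) ?_
  exact primrec_back.comp (Primrec.pair (hd.comp fst) snd)

end Ineq

/-- The decomposition algorithm. -/
def decompose (c : InputCode) : List PathSchemeCode :=
  ((expand c.2.2.2.2).filter (Ineq.Feasible c.1 c.2.2.1 c.2.2.2.1 ·)).map toRaw

theorem primrec_decompose : Primrec decompose :=
  list_map (list_filter (p := fun (c : InputCode) s => Ineq.Feasible c.1 c.2.2.1 c.2.2.2.1 s)
    (primrec_expand.comp (snd.comp (snd.comp (snd.comp snd))))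
    (Ineq.primrec_feasible (fst.comp fst) (fst.comp (snd.comp (snd.comp fst)))
      (fst.comp (snd.comp (snd.comp (snd.comp fst)))) snd)) (primrec_toRaw.comp snd)

/-! ### Renaming of letters, and the main theorem -/

section Map

variable {α β : Type} [DecidableEq α] [DecidableEq β] {φ : α → β}

/-- The enumeration inspects letters only through equality, which injective renamings preserve. This
allows reasoning over `S` about an algorithm that runs on codes. -/
theorem nodupLists_map (hφ : Function.Injective φ) (A : List α) (k : ℕ) :
    nodupLists (A.map φ) k = (nodupLists A k).map (List.map φ) := by
  induction k with
  | zero => rfl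
  | succ k ih =>
    simp only [nodupLists, ih, List.flatMap_map, List.map_flatMap, List.mem_map_of_injective hφ]
    congr 1; funext l; congr 1; funext c
    split_ifs <;> rfl

theorem gatherings_map (hφ : Function.Injective φ) (A : List α) (k : ℕ) :
    gatherings (A.map φ) k = (gatherings A k).map (List.map (Atom.map φ)) := by
  simp only [gatherings, nodupLists_map hφ, List.flatMap_map, List.map_flatMap,
    List.forall_mem_map, List.mem_map_of_injective hφ]
  congr 1; funext a; congr 1; funext b
  split_ifs <;> rfl

theorem starSchemes_map (hφ : Function.Injective φ) (A : List α) (k : ℕ) :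
    starSchemes (A.map φ) k = (starSchemes A k).map (List.map (Atom.map φ)) := by
  induction k with
  | zero => rfl
  | succ k ih =>
    simp only [starSchemes, ih, gatherings_map hφ, List.flatMap_map, List.map_flatMap,
      List.map_append, List.map_map]
    congr 2; congr 1; funext s; congr 1; funext s'
    refine List.map_congr_left fun c _ => ?_
    simp [Atom.map]

/-- Renaming of the letters. -/
def RawBubble.map (φ : α → β) : RawBubble α → RawBubble β :=
  Sum.map (List.map φ) (Prod.map (List.map φ) (List.map φ))

/-- Renaming of the letters. -/
def RawScheme.map (φ : α → β) : RawScheme α → RawScheme β :=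
  Prod.map (List.map φ) (List.map (Prod.map (RawBubble.map φ) (List.map φ)))

theorem expandBubble_map (hφ : Function.Injective φ) (b : RawBubble α) :
    expandBubble (b.map φ) = (expandBubble b).map (List.map (Atom.map φ)) := by
  rcases b with A | p
  · simp only [RawBubble.map, Sum.map_inl, expandBubble, List.dedup_map_of_injective hφ,
      List.length_map, starSchemes_map hφ]
  · rfl

theorem expand_map (hφ : Function.Injective φ) (c : RawScheme α) :
    expand (c.map φ) = (expand c).map (List.map (Atom.map φ)) := by
  have hinl : ∀ u : List α, (u.map φ).map (Sum.inl : β → Atom β) =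
      (u.map Sum.inl).map (Atom.map φ) := fun u => by
    rw [List.map_map, List.map_map]
    rfl
  have h : ∀ l : List (RawBubble α × List α),
      expandTail (l.map (Prod.map (RawBubble.map φ) (List.map φ))) =
        (expandTail l).map (List.map (Atom.map φ)) := by
    intro l
    induction l with
    | nil => rfl
    | cons p l ih =>
      have hcons : ∀ {γ : Type} [DecidableEq γ] (p : RawBubble γ × List γ) l,
          expandTail (p :: l) = (expandBubble p.1).flatMap fun s =>
            (expandTail l).map fun r => s ++ (p.2.map Sum.inl ++ r) := fun _ _ => rfl
      rw [List.map_cons, hcons, ih, hcons]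
      simp only [Prod.map_fst, Prod.map_snd, expandBubble_map hφ, List.flatMap_map,
        List.map_flatMap, List.map_map]
      congr 1; funext s
      refine List.map_congr_left fun r _ => ?_
      simp only [Function.comp_apply, ← hinl, List.map_append, List.map_map]
  simp only [expand, RawScheme.map, Prod.map_fst, Prod.map_snd, h, List.map_map]
  refine List.map_congr_left fun r _ => ?_
  simp only [Function.comp_apply, ← hinl, List.map_append, List.map_map]

end Map

/-! ### From codes to path-schemes over the system -/

section Codes

open Ineq

variable {d : ℕ} {S : Finset (Fin d → ℤ)}

theorem letterCode_injective : Function.Injective (letterCode : S → List ℤ) := fun _ _ h =>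
  Subtype.ext (List.ofFn_injective h)

theorem exists_map_eq_of_forall {α β : Type} {φ : α → β} (c : List β)
    (h : ∀ b ∈ c, ∃ a, φ a = b) : ∃ l : List α, c = l.map φ := by
  induction c with
  | nil => exact ⟨[], rfl⟩
  | cons b c ih =>
    obtain ⟨⟨a, rfl⟩, h'⟩ := List.forall_mem_cons.1 h
    obtain ⟨l, rfl⟩ := ih h'
    exact ⟨a :: l, rfl⟩

theorem exists_rawBubble {c : BubbleCode} {X : Bubble S} (h : IsBubbleCode c X) :
    ∃ b : RawBubble S, c = b.map letterCode ∧ b.Describes X := by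
  match c, X, h with
  | .inl c, .star A, h =>
    obtain ⟨l, rfl⟩ := exists_map_eq_of_forall (φ := (letterCode : S → List ℤ)) c fun b hb => by
      obtain ⟨t, -, ht⟩ := (h b).1 hb
      exact ⟨t, ht⟩
    refine ⟨.inl l, rfl, fun t => ?_⟩
    rw [← List.mem_map_of_injective letterCode_injective, h]
    constructor
    · rintro ⟨s, hs, hst⟩
      rwa [← letterCode_injective hst]
    · exact fun ht => ⟨t, ht, rfl⟩
  | .inr c, .gathering a b ha hb hab, h =>
    exact ⟨.inr (a, b), congrArg Sum.inr (Prod.ext h.1 h.2), rfl, rfl⟩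

theorem exists_rawScheme {c : PathSchemeCode} {ρ : PathScheme S} (h : IsPathSchemeCode c ρ) :
    ∃ r : RawScheme S, c = r.map letterCode ∧ r.Describes ρ := by
  obtain ⟨u, c⟩ := c
  obtain ⟨v, τ⟩ := ρ
  have key : ∃ r : List (RawBubble S × List S),
      c = r.map (Prod.map (RawBubble.map letterCode) (List.map letterCode)) ∧
        List.Forall₂ (fun p q => RawBubble.Describes p.1 q.1 ∧ p.2 = q.2) r τ := by
    obtain ⟨-, h⟩ := h
    dsimp only at h
    induction h with
    | nil => exact ⟨[], rfl, .nil⟩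
    | @cons p q c τ hpq h ih =>
      obtain ⟨r, rfl, hr⟩ := ih
      obtain ⟨b, hb, hbX⟩ := exists_rawBubble hpq.1
      exact ⟨(b, q.2) :: r, by rw [List.map_cons]; exact congrArg (· :: _) (Prod.ext hb hpq.2),
        .cons ⟨hbX, rfl⟩ hr⟩
  obtain ⟨r, rfl, hr⟩ := key
  exact ⟨(v, r), Prod.ext h.1 rfl, rfl, hr⟩

theorem isPathSchemeCode_toRaw {s : List (Atom S)} (hs : ∀ x ∈ s, x.Valid) :
    IsPathSchemeCode (toRaw (s.map (Atom.map letterCode))) (Atom.toScheme s) := by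
  induction s with
  | nil => exact ⟨rfl, .nil⟩
  | cons x s ih =>
    rw [List.forall_mem_cons] at hs
    obtain ⟨ih₁, ih₂⟩ := ih hs.2
    rcases x with t | ⟨a, b⟩
    · exact ⟨congrArg (letterCode t :: ·) ih₁, ih₂⟩
    · obtain ⟨ha, hb, hab⟩ := hs.1
      refine ⟨rfl, .cons ⟨?_, ih₁⟩ ih₂⟩
      show IsBubbleCode _ (Atom.bubble (a, b))
      rw [Atom.bubble_eq ha hb hab]
      exact ⟨rfl, rfl⟩

theorem decompose_spec {x y : CVAS.Conf d} {ρ : PathScheme S} {c : InputCode}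
    (hc : IsInputCode c S x y ρ) :
    ∃ R : List (PathScheme S),
      List.Forall₂ IsPathSchemeCode (decompose c) R ∧
      (∀ σ ∈ R, σ.Perfect x y) ∧
      ρ.lang ⊓ CVAS.lang S x y = (⨆ σ ∈ R, σ.lang) ⊓ CVAS.lang S x y ∧
      (∀ σ ∈ R, LexLE σ.weight ρ.weight) := by
  classical
  obtain ⟨d', _, cx, cy, cρ⟩ := c
  obtain ⟨hd, -, hx, hy, hρ⟩ := hc
  dsimp only at hd hx hy hρ
  subst d'
  obtain ⟨r, rfl, hr⟩ := exists_rawScheme hρ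
  obtain ⟨hlang, hprop⟩ := expand_spec hr
  have hfeas : ∀ s ∈ expand r, (Feasible d cx cy (s.map (Atom.map letterCode)) ↔
      ∃ w ∈ Atom.seqLang s, CVAS.Reach x w y) := fun s hs => feasible_iff hx hy (hprop s hs).1
  refine ⟨((expand r).filter fun s => Feasible d cx cy (s.map (Atom.map letterCode))).map
    Atom.toScheme, ?_, ?_, ?_, ?_⟩
  · simp only [decompose, expand_map letterCode_injective, List.filter_map, List.map_map,
      List.forall₂_map_left_iff, List.forall₂_map_right_iff, Function.comp_def, List.forall₂_same]
    intro s hs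
    exact isPathSchemeCode_toRaw (hprop s (List.mem_filter.1 hs).1).1
  · simp only [List.forall_mem_map, List.mem_filter, decide_eq_true_eq]
    rintro s ⟨hs, hf⟩
    obtain ⟨w, hw, hr⟩ := (hfeas s hs).1 hf
    exact ⟨Atom.prePerfect_toScheme (hprop s hs).1, w, by rwa [Atom.lang_toScheme], hr⟩
  · ext w
    have hmem : ∀ (L L' : Language S) w, w ∈ L ⊓ L' ↔ w ∈ L ∧ w ∈ L' := fun _ _ _ => Iff.rfl
    have hsup : ∀ (T : List (PathScheme S)) (w : List S),
        w ∈ (⨆ σ ∈ T, σ.lang) ↔ ∃ σ ∈ T, w ∈ σ.lang := fun T w => by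
      simp only [Language.mem_iSup, exists_prop]
    rw [hmem, hmem, hsup, hlang]
    simp only [List.mem_map, List.mem_filter, decide_eq_true_eq]
    -- Discarding infeasible schemes loses nothing: a word `w` of the transition language itself
    -- witnesses that its scheme is feasible.
    constructor
    · rintro ⟨⟨s, hs, hw⟩, hxy⟩
      exact ⟨⟨_, ⟨s, ⟨hs, (hfeas s hs).2 ⟨w, hw, hxy⟩⟩, rfl⟩, by rwa [Atom.lang_toScheme]⟩, hxy⟩
    · rintro ⟨⟨_, ⟨s, ⟨hs, -⟩, rfl⟩, hw⟩, hxy⟩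
      rw [Atom.lang_toScheme] at hw
      exact ⟨⟨s, hs, hw⟩, hxy⟩
  · simp only [List.forall_mem_map, List.mem_filter]
    rintro s ⟨hs, -⟩
    exact (hprop s hs).2

end Codes

/-- Path-scheme decomposition: one computable function `f` maps every description of a system,
two configurations and a path-scheme `ρ` to descriptions of the perfect path-schemes of a
decomposition of `ρ`. -/
theorem mainTheorem6 :
    ∃ f : InputCode → List PathSchemeCode, Computable f ∧
      ∀ (d : ℕ) (S : Finset (Fin d → ℤ)) (x y : CVAS.Conf d) (ρ : PathScheme S) (c : InputCode),
        IsInputCode c S x y ρ →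
        ∃ R : List (PathScheme S),
          List.Forall₂ IsPathSchemeCode (f c) R ∧
          (∀ σ ∈ R, σ.Perfect x y) ∧
          ρ.lang ⊓ CVAS.lang S x y = (⨆ σ ∈ R, σ.lang) ⊓ CVAS.lang S x y ∧
          (∀ σ ∈ R, LexLE σ.weight ρ.weight) :=
  ⟨decompose, primrec_decompose.to_comp, fun _ _ _ _ _ _ hc => decompose_spec hc⟩
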